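/- Let $T>0$, $R>0$. Let $F\in C^1_c(\mathbb R)$ be even and nonnegative, and let $f_0\in C^1(\mathbb R^2)$ be nonnegative, compactly supported in $v$ uniformly in $x$ (there is $P$ with $f_0(x,v)=0$ for all $x$ and all $|v|>P$), with $f_0(x,v)=F(v)$ for all $|x|>R$, $v\in\mathbb R$. Let $f\in C^1([0,T]\times\mathbb R^2)$ be a solution of the one-dimensional Vlasov–Poisson system $$\partial_t f+v\,\partial_x f-E\,\partial_v f=0,\qquad \rho(t,x)=\int_{\mathbb R}\bigl(F(v)-f(t,x,v)\bigr)\,dv,$$ $$E(t,x)=\tfrac12\Bigl(\int_{-\infty}^x\rho(t,y)\,dy-\int_x^\infty\rho(t,y)\,dy\Bigr),\qquad f(0,x,v)=f_0(x,v)$$ on $[0,T]\times\mathbb R^2$ (in particular the integrals defining $\rho$ and $E$ converge absolutely), and assume that $\int_0^T\|E(\tau)\|_\infty\,d\tau<\infty$, where $\|E(\tau)\|_\infty=\sup_{x}|E(\tau,x)|$. For $t\in[0,T]$ put $$Q_g(t)=\sup\{|v| : F(v)-f(\tau,x,v)\neq0\ \text{for some } x\in\mathbb R,\ \tau\in[0,t]\}$$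 (with $\sup\emptyset=0$) and $$R(t)=R+t\,Q_g(t)+\int_0^t\int_\tau^t\|E(s)\|_\infty\,ds\,d\tau .$$ Let $\operatorname{sign}(x)=1$ for $x\ge0$ and $-1$ for $x<0$, and $$E^0=\frac12\int_{-R}^{R}\int_{\mathbb R}\bigl(F(v)-f_0(y,v)\bigr)\,dv\,dy,\qquad \omega=\Bigl(\int_{\mathbb R}F(v)\,dv\Bigr)^{1/2}.$$ Then for every $t\in[0,T]$ and every $x$ with $|x|>R(t)$, $$E(t,x)=E^0\operatorname{sign}(x)\cos(\omega t)$$ and, for every $v\in\mathbb R$, $$f(t,x,v)=F\Bigl(v+\frac{E^0\operatorname{sign}(x)}{\omega}\sin(\omega t)\Bigr).$$ (If $\omega=0$, then $F\equiv0$ and the last identity reads $f(t,x,v)=0$.) -/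

import Mathlib

open MeasureTheory Set

namespace VlasovPoisson

noncomputable section

/-- The charge density `ρ(t,x) = ∫ (F(v) - f(t,x,v)) dv`. -/
def chargeDensity (F : ℝ → ℝ) (f : ℝ → ℝ → ℝ → ℝ) (t x : ℝ) : ℝ :=
  ∫ v, (F v - f t x v)

/-- The electric field
`E(t,x) = (1/2) (∫_{-∞}^x ρ(t,y) dy - ∫_x^∞ ρ(t,y) dy)`. -/
def electricField (F : ℝ → ℝ) (f : ℝ → ℝ → ℝ → ℝ) (t x : ℝ) : ℝ :=
  (1 / 2) * ((∫ y in Iic x, chargeDensity F f t y) - ∫ y in Ioi x, chargeDensity F f t y)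

/-- `f` is a `C¹` solution on `[0,T] × ℝ²` of the one-dimensional Vlasov-Poisson system with
background `F` and initial datum `f₀`. The two integrability fields say that the integrals
defining `ρ` and `E` exist. The time derivative is one-sided at `t = 0` and `t = T`. -/
structure IsC1Solution (T : ℝ) (F : ℝ → ℝ) (f₀ : ℝ → ℝ → ℝ) (f : ℝ → ℝ → ℝ → ℝ) : Prop where
  contDiffOn : ContDiffOn ℝ 1 (fun p : ℝ × ℝ × ℝ => f p.1 p.2.1 p.2.2) (Icc 0 T ×ˢ univ)
  integrable_velocity : ∀ t ∈ Icc 0 T, ∀ x, Integrable (fun v => F v - f t x v)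
  integrable_density : ∀ t ∈ Icc 0 T, Integrable (fun x => chargeDensity F f t x)
  vlasov : ∀ t ∈ Icc 0 T, ∀ x v,
    derivWithin (fun τ => f τ x v) (Icc 0 T) t + v * deriv (fun y => f t y v) x
      - electricField F f t x * deriv (fun w => f t x w) v = 0
  initial : ∀ x v, f 0 x v = f₀ x v

/-- The assumptions on the data: `F ∈ C¹_c(ℝ)` is even and nonnegative, `f₀ ∈ C¹(ℝ²)` is
nonnegative and compactly supported in `v`, uniformly in `x`, and `f₀(x,v) = F(v)` for
`|x| > R`. -/
structure IsAdmissibleData (R : ℝ) (F : ℝ → ℝ) (f₀ : ℝ → ℝ → ℝ) : Prop where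
  radius_pos : 0 < R
  background_contDiff : ContDiff ℝ 1 F
  background_hasCompactSupport : HasCompactSupport F
  background_even : ∀ v, F (-v) = F v
  background_nonneg : ∀ v, 0 ≤ F v
  initial_contDiff : ContDiff ℝ 1 (fun p : ℝ × ℝ => f₀ p.1 p.2)
  initial_velocity_support : ∃ P : ℝ, ∀ x v, P < |v| → f₀ x v = 0
  initial_nonneg : ∀ x v, 0 ≤ f₀ x v
  initial_eq_background : ∀ x v, R < |x| → f₀ x v = F v

/-- `‖E(t)‖_∞ = sup_x |E(t,x)|`. -/
def fieldSupNorm (F : ℝ → ℝ) (f : ℝ → ℝ → ℝ → ℝ) (t : ℝ) : ℝ :=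
  ⨆ x : ℝ, |electricField F f t x|

/-- The field bound: `∫_0^T ‖E(τ)‖_∞ dτ ≤ C` for some `C > 0` (the integral being finite). -/
def HasFieldBound (T : ℝ) (F : ℝ → ℝ) (f : ℝ → ℝ → ℝ → ℝ) : Prop :=
  IntervalIntegrable (fieldSupNorm F f) volume 0 T ∧
    ∃ C : ℝ, 0 < C ∧ ∫ τ in (0 : ℝ)..T, fieldSupNorm F f τ ≤ C

/-- `Q_g(t)`: the supremum of `|v|` over those `v` for which `F(v) - f(τ,x,v) ≠ 0` for some
`x ∈ ℝ` and `τ ∈ [0,t]` (zero if there are none). -/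
def velocityRadius (F : ℝ → ℝ) (f : ℝ → ℝ → ℝ → ℝ) (t : ℝ) : ℝ :=
  sSup {r : ℝ | ∃ v x : ℝ, ∃ τ ∈ Icc 0 t, F v - f τ x v ≠ 0 ∧ r = |v|}

/-- `R(t) = R + t Q_g(t) + ∫_0^t ∫_τ^t ‖E(s)‖_∞ ds dτ`. -/
def spatialRadius (R : ℝ) (F : ℝ → ℝ) (f : ℝ → ℝ → ℝ → ℝ) (t : ℝ) : ℝ :=
  R + t * velocityRadius F f t + ∫ τ in (0 : ℝ)..t, ∫ s in τ..t, fieldSupNorm F f s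

/-- `sign(x) = 1` for `x ≥ 0` and `-1` for `x < 0`. -/
def sgn (x : ℝ) : ℝ := if 0 ≤ x then 1 else -1

/-- `E⁰ = (1/2) ∫_{-R}^R ∫ (F(v) - f₀(y,v)) dv dy`. -/
def initialFieldStrength (R : ℝ) (F : ℝ → ℝ) (f₀ : ℝ → ℝ → ℝ) : ℝ :=
  (1 / 2) * ∫ y in (-R)..R, ∫ v, (F v - f₀ y v)

/-- `ω = (∫ F(v) dv)^{1/2}`. -/
def frequency (F : ℝ → ℝ) : ℝ := √(∫ v, F v)

end

end VlasovPoisson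

/-!
A priori the field `E` is only integrable in time. Trajectories of fields that are Lipschitz in
space and close to `E` in `L¹` of time nevertheless carry bounds from `f₀` to `f`: the solution is
bounded and compactly supported in velocity. Hence Ampère's law `∂ₜE = j - ∫ v F dv` holds, where
`j` is the momentum density, `E` is continuous, and characteristics exist.

As `x → ±∞` the field tends to `±A(t)`, where `A` is half of the total charge, and `f` tends to
`F(v ± ∫₀ᵗ A)`. Ampère's law at infinity reads `A' = -ω² ∫₀ᵗ A` with `A(0) = E⁰`, so
`A = E⁰ cos ωt`.

Outside the radius `R(t)` the limits are attained. A characteristic that ends there at time `t` with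
a speed at most `Q_g(t)` was outside the radius `R(s)`, on the same side, at every earlier time `s`,
and started where `f₀ = F`. Hence the deviation of `f` from its limit is controlled by that of `E`
at earlier times `s` outside the radius `R(s)`, and Ampère's law returns a bound for the deviation
of `E`. A Grönwall argument shows that both vanish.
-/

namespace VlasovPoisson

open Filter Topology
open scoped NNReal

lemma exists_lipschitzOnWith_dist_lt {E F : Type*} [NormedAddCommGroup E] [NormedSpace ℝ E]
    [FiniteDimensional ℝ E] [NormedAddCommGroup F] [NormedSpace ℝ F] {f : E → F}
    (hf : Continuous f) {K : Set E} (hK : IsCompact K) (hconv : Convex ℝ K) {ε : ℝ} (hε : 0 < ε) :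
    ∃ g : E → F, ∃ L, LipschitzOnWith L g K ∧ ∀ x, dist (g x) (f x) < ε := by
  obtain ⟨g, hg, hgf, -⟩ := hf.exists_contDiff_approx 1 continuous_const fun _ => hε
  obtain ⟨L, hL⟩ := hg.contDiffOn.exists_lipschitzOnWith one_ne_zero hconv hK
  exact ⟨g, L, hL, hgf⟩

lemma stronglyMeasurable_continuousMap {α X : Type*} [MeasurableSpace α] [PseudoMetricSpace X]
    [CompactSpace X] {u : α → C(X, ℝ)} (hu : ∀ x, Measurable fun a => u a x) :
    StronglyMeasurable u := by
  borelize C(X, ℝ)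
  have hbasis : TopologicalSpace.IsTopologicalBasis
      {U : Set C(X, ℝ) | ∃ g r, U = Metric.ball g r} :=
    TopologicalSpace.isTopologicalBasis_of_isOpen_of_nhds
      (by rintro _ ⟨g, r, rfl⟩; exact Metric.isOpen_ball) fun g U hg hU =>
      let ⟨r, hr, hrU⟩ := Metric.isOpen_iff.1 hU g hg
      ⟨_, ⟨g, r, rfl⟩, Metric.mem_ball_self hr, hrU⟩
  obtain ⟨D, hDc, hD⟩ := TopologicalSpace.exists_countable_dense X
  have hnorm (g : C(X, ℝ)) : Measurable fun a => ‖u a - g‖ := by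
    have := hDc.to_subtype
    have hsup (a : α) : ‖u a - g‖ = ⨆ x : D, ‖(u a - g) x‖ := by
      rw [ContinuousMap.norm_eq_iSup_norm, ← hD.ciSup' (u a - g).continuous.norm]
    simp only [hsup]
    exact .iSup fun x => ((hu x).sub_const _).norm
  refine Measurable.stronglyMeasurable ?_
  rw [BorelSpace.measurable_eq (α := C(X, ℝ)), hbasis.borel_eq_generateFrom]
  refine measurable_generateFrom ?_
  rintro _ ⟨g, r, rfl⟩
  simpa only [preimage, Metric.mem_ball, dist_eq_norm]
    using measurableSet_lt (hnorm g) measurable_const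

lemma exists_lipschitz_bounded_forall_abs_sub_le {T K : ℝ} (hT : 0 ≤ T) (hK : -K ≤ K)
    {g : ℝ → C(Icc (-K) K, ℝ)} (hg : Continuous g) {ε : ℝ} (hε : 0 < ε) :
    ∃ G : ℝ × ℝ → ℝ, (∃ L, LipschitzWith L G) ∧ (∃ B, ∀ p, |G p| ≤ B) ∧
      ∀ s ∈ Icc 0 T, ∀ x, |g s (projIcc (-K) K hK x) - G (s, x)| ≤ ε := by
  have hprod : IsCompact (Icc 0 T ×ˢ Icc (-K) K) := isCompact_Icc.prod isCompact_Icc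
  have hcont : Continuous fun p : ℝ × ℝ => g p.1 (projIcc (-K) K hK p.2) := by
    fun_prop
  obtain ⟨h, L, hL, hhg⟩ := exists_lipschitzOnWith_dist_lt hcont hprod
    ((convex_Icc _ _).prod (convex_Icc _ _)) hε
  obtain ⟨B, hB⟩ := hprod.exists_bound_of_continuousOn hL.continuousOn
  let proj (p : ℝ × ℝ) : ℝ × ℝ := (projIcc 0 T hT p.1, projIcc (-K) K hK p.2)
  have hproj (p) : proj p ∈ Icc 0 T ×ˢ Icc (-K) K := ⟨Subtype.prop _, Subtype.prop _⟩
  have hprojL : LipschitzWith 1 proj := by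
    have h₁ : LipschitzWith (1 * (1 * 1)) fun p : ℝ × ℝ => (projIcc 0 T hT p.1 : ℝ) :=
      (LipschitzWith.subtype_val _).comp ((LipschitzWith.projIcc hT).comp LipschitzWith.prod_fst)
    have h₂ : LipschitzWith (1 * (1 * 1)) fun p : ℝ × ℝ => (projIcc (-K) K hK p.2 : ℝ) :=
      (LipschitzWith.subtype_val _).comp ((LipschitzWith.projIcc hK).comp LipschitzWith.prod_snd)
    simpa using h₁.prodMk h₂
  refine ⟨h ∘ proj, ⟨L * 1, lipschitzOnWith_univ.1 (hL.comp hprojL.lipschitzOnWith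
    fun p _ => hproj p)⟩, ⟨B, fun p => hB _ (hproj p)⟩, fun s hs x => ?_⟩
  have hclose := (hhg (proj (s, x))).le
  simp only [proj, projIcc_of_mem hT hs, projIcc_val] at hclose
  rw [abs_sub_comm, ← Real.dist_eq]
  simpa only [Function.comp_apply, proj, projIcc_of_mem hT hs] using hclose

section Approximation

variable {T : ℝ} {E : ℝ → C(ℝ, ℝ)} {e : ℝ → ℝ}

lemma exists_continuous_integral_norm_restrict_sub_le (hT : 0 ≤ T) (K : ℝ)
    (he : IntervalIntegrable e volume 0 T) (hm : ∀ x, Measurable fun s => E s x)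
    (hEe : ∀ s ∈ Icc 0 T, ∀ x, |E s x| ≤ e s) {ε : ℝ} (hε : 0 < ε) :
    ∃ g : ℝ → C(Icc (-K) K, ℝ), Continuous g ∧
      IntervalIntegrable (fun s => ‖(E s).restrict (Icc (-K) K) - g s‖) volume 0 T ∧
      ∫ s in 0..T, ‖(E s).restrict (Icc (-K) K) - g s‖ ≤ ε := by
  have hint : Integrable (fun s => (E s).restrict (Icc (-K) K)) (volume.restrict (Ioc 0 T)) := by
    refine ⟨(stronglyMeasurable_continuousMap (X := Icc (-K) K) fun x =>
      hm x).aestronglyMeasurable,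
      ContinuousMap.hasFiniteIntegral_of_bound _ e he.1.hasFiniteIntegral ?_⟩
    filter_upwards [ae_restrict_mem measurableSet_Ioc] with s hs
    exact fun x => hEe s (Ioc_subset_Icc_self hs) x
  obtain ⟨g, -, hle, hg, hgi⟩ := hint.exists_hasCompactSupport_integral_sub_le hε
  rw [← intervalIntegral.integral_of_le hT] at hle
  exact ⟨g, hg, (intervalIntegrable_iff_integrableOn_Ioc_of_le hT).2 (hint.sub hgi).norm, hle⟩

lemma exists_lipschitz_integral_approx (hT : 0 ≤ T) {K : ℝ} (hK : 0 ≤ K)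
    (he : IntervalIntegrable e volume 0 T) (hm : ∀ x, Measurable fun s => E s x)
    (hEe : ∀ s ∈ Icc 0 T, ∀ x, |E s x| ≤ e s) {ε : ℝ} (hε : 0 < ε) :
    ∃ G : ℝ × ℝ → ℝ, (∃ L, LipschitzWith L G) ∧ (∃ B, ∀ p, |G p| ≤ B) ∧
      ∃ w : ℝ → ℝ, IntervalIntegrable w volume 0 T ∧ ∫ s in 0..T, w s ≤ ε ∧
        ∀ s ∈ Icc 0 T, (∀ x, |x| ≤ K → |E s x - G (s, x)| ≤ w s) ∧
          ∀ x, |G (s, x)| ≤ e s + w s := by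
  have hK' : -K ≤ K := by linarith
  obtain ⟨g, hg, hgi, hgε⟩ :=
    exists_continuous_integral_norm_restrict_sub_le hT K he hm hEe (half_pos hε)
  set η := ε / 2 / (T + 1)
  have hη : 0 < η := by positivity
  obtain ⟨G, hGL, hGB, hG⟩ := exists_lipschitz_bounded_forall_abs_sub_le hT hK' hg hη
  set w : ℝ → ℝ := fun s => ‖(E s).restrict (Icc (-K) K) - g s‖ + η
  have happrox : ∀ s ∈ Icc 0 T, ∀ x, |E s (projIcc (-K) K hK' x) - G (s, x)| ≤ w s := fun s hs x =>
    (abs_sub_le _ (g s (projIcc (-K) K hK' x)) _).trans (add_le_add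
      (((E s).restrict (Icc (-K) K) - g s).norm_coe_le_norm _) (hG s hs x))
  refine ⟨G, hGL, hGB, w, hgi.add intervalIntegrable_const, ?_, fun s hs =>
    ⟨fun x hx => ?_, fun x => ?_⟩⟩
  · have hηT : T * η ≤ ε / 2 := by
      rw [mul_div_assoc', div_le_iff₀ (by positivity)]
      nlinarith
    rw [intervalIntegral.integral_add hgi intervalIntegrable_const,
      intervalIntegral.integral_const, smul_eq_mul, sub_zero]
    linarith
  · simpa only [projIcc_of_mem hK' (abs_le.1 hx)] using happrox s hs x
  · linarith [happrox s hs x, hEe s hs (projIcc (-K) K hK' x),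
      abs_sub_abs_le_abs_sub (G (s, x)) (E s (projIcc (-K) K hK' x)),
      abs_sub_comm (G (s, x)) (E s (projIcc (-K) K hK' x))]

end Approximation

lemma exists_hasDerivWithinAt_of_lipschitz_of_bound {E : Type*} [NormedAddCommGroup E]
    [NormedSpace ℝ E] [CompleteSpace E] {Φ : ℝ → E → E} {a b : ℝ} {L : ℝ≥0} {B : ℝ}
    (hc : ∀ x, ContinuousOn (fun s => Φ s x) (Icc a b))
    (hL : ∀ s ∈ Icc a b, LipschitzWith L (Φ s)) (hB : ∀ s ∈ Icc a b, ∀ x, ‖Φ s x‖ ≤ B)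
    {t₀ : ℝ} (ht₀ : t₀ ∈ Icc a b) (x₀ : E) :
    ∃ α : ℝ → E, α t₀ = x₀ ∧ ∀ s ∈ Icc a b, HasDerivWithinAt α (Φ s (α s)) (Icc a b) s := by
  have hB₀ : 0 ≤ B := (norm_nonneg _).trans (hB t₀ ht₀ x₀)
  lift B to ℝ≥0 using hB₀
  have hpl : IsPicardLindelof Φ ⟨t₀, ht₀⟩ x₀ (B * (max (b - t₀) (t₀ - a)).toNNReal) 0 B L := by
    refine ⟨fun s hs => (hL s hs).lipschitzOnWith, fun x _ => hc x, fun s hs x _ => hB s hs x, ?_⟩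
    simp [Real.coe_toNNReal _ (le_max_of_le_left (sub_nonneg.2 ht₀.2))]
  exact hpl.exists_eq_forall_mem_Icc_hasDerivWithinAt₀

/-- `(X, V)` solves `X' = V`, `V' = -γ` on `[0, t]` for a continuous `γ`: a particle trajectory on
which the field `γ` is felt. -/
structure IsTrajectory (t : ℝ) (γ X V : ℝ → ℝ) : Prop where
  continuousOn : ContinuousOn γ (Icc 0 t)
  position : ∀ s ∈ Icc 0 t, HasDerivWithinAt X (V s) (Icc 0 t) s
  velocity : ∀ s ∈ Icc 0 t, HasDerivWithinAt V (-γ s) (Icc 0 t) s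

lemma integral_eq_sub_of_hasDerivWithinAt_Icc {a b r t : ℝ} {φ φ' : ℝ → ℝ}
    (h : ∀ s ∈ Icc a b, HasDerivWithinAt φ (φ' s) (Icc a b) s) (hc : ContinuousOn φ' (Icc a b))
    (hr : r ∈ Icc a b) (ht : t ∈ Icc a b) : ∫ s in r..t, φ' s = φ t - φ r := by
  have hsub : uIcc r t ⊆ Icc a b := uIcc_subset_Icc hr ht
  refine intervalIntegral.integral_eq_sub_of_hasDeriv_right
    (fun s hs => ((h s (hsub hs)).continuousWithinAt).mono hsub) (fun s hs => ?_)
    (hc.mono hsub).intervalIntegrable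
  have hs' : s ∈ Ioo a b :=
    ⟨(le_min hr.1 ht.1).trans_lt hs.1, hs.2.trans_le (max_le hr.2 ht.2)⟩
  exact ((h s (Ioo_subset_Icc_self hs')).hasDerivAt (Icc_mem_nhds hs'.1 hs'.2)).hasDerivWithinAt

lemma eq_of_hasDerivWithinAt_zero {a b : ℝ} {φ : ℝ → ℝ}
    (h : ∀ s ∈ Icc a b, HasDerivWithinAt φ 0 (Icc a b) s) {r t : ℝ} (hr : r ∈ Icc a b)
    (ht : t ∈ Icc a b) : φ t = φ r := by
  have hint := integral_eq_sub_of_hasDerivWithinAt_Icc h continuousOn_const hr ht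
  rw [intervalIntegral.integral_zero] at hint
  exact sub_eq_zero.1 hint.symm

namespace IsTrajectory

variable {t : ℝ} {γ X V b : ℝ → ℝ}

lemma continuousOn_velocity (h : IsTrajectory t γ X V) : ContinuousOn V (Icc 0 t) :=
  fun s hs => (h.velocity s hs).continuousWithinAt

lemma continuousOn_position (h : IsTrajectory t γ X V) : ContinuousOn X (Icc 0 t) :=
  fun s hs => (h.position s hs).continuousWithinAt

lemma velocity_eq (h : IsTrajectory t γ X V) {s : ℝ} (hs : s ∈ Icc 0 t) :
    V s = V t + ∫ r in s..t, γ r := by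
  have := integral_eq_sub_of_hasDerivWithinAt_Icc h.velocity h.continuousOn.neg hs
    ⟨hs.1.trans hs.2, le_rfl⟩
  rw [intervalIntegral.integral_neg] at this
  linarith

lemma position_eq (h : IsTrajectory t γ X V) {s : ℝ} (hs : s ∈ Icc 0 t) :
    X s = X t - ∫ r in s..t, V r := by
  have := integral_eq_sub_of_hasDerivWithinAt_Icc h.position h.continuousOn_velocity hs
    ⟨hs.1.trans hs.2, le_rfl⟩
  linarith

lemma abs_velocity_sub_le (h : IsTrajectory t γ X V) (hb : IntervalIntegrable b volume 0 t)
    (hγ : ∀ s ∈ Icc 0 t, |γ s| ≤ b s) {s : ℝ} (hs : s ∈ Icc 0 t) :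
    |V s - V t| ≤ ∫ r in s..t, b r := by
  rw [h.velocity_eq hs, add_sub_cancel_left, ← Real.norm_eq_abs]
  refine intervalIntegral.norm_integral_le_of_norm_le hs.2
    (Eventually.of_forall fun r hr => hγ r ⟨hs.1.trans hr.1.le, hr.2⟩)
    (hb.mono_set (uIcc_subset_uIcc_right ?_))
  rwa [uIcc_of_le (hs.1.trans hs.2)]

lemma continuousOn_tail_integral (hb : IntervalIntegrable b volume 0 t)
    (ht : 0 ≤ t) :
    ContinuousOn (fun s => ∫ r in s..t, b r) (Icc 0 t) := by
  have h1 : ContinuousOn (fun s => ∫ r in t..s, b r) (uIcc 0 t) :=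
    intervalIntegral.continuousOn_primitive_interval' hb right_mem_uIcc
  rw [uIcc_of_le ht] at h1
  exact h1.neg.congr fun s _ => intervalIntegral.integral_symm _ _

lemma abs_position_sub_le (h : IsTrajectory t γ X V) (hb : IntervalIntegrable b volume 0 t)
    (hγ : ∀ s ∈ Icc 0 t, |γ s| ≤ b s) {s : ℝ} (hs : s ∈ Icc 0 t) :
    |X s - X t| ≤ (t - s) * |V t| + ∫ τ in s..t, ∫ r in τ..t, b r := by
  have hsub : uIcc s t ⊆ Icc 0 t := uIcc_subset_Icc hs ⟨hs.1.trans hs.2, le_rfl⟩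
  have hi : IntervalIntegrable (fun τ => ∫ r in τ..t, b r) volume s t :=
    ((continuousOn_tail_integral hb (hs.1.trans hs.2)).mono hsub).intervalIntegrable
  have hV : ∀ r ∈ Ioc s t, ‖V r‖ ≤ |V t| + ∫ q in r..t, b q := fun r hr => by
    linarith [h.abs_velocity_sub_le hb hγ (s := r) ⟨hs.1.trans hr.1.le, hr.2⟩,
      abs_sub_abs_le_abs_sub (V r) (V t), Real.norm_eq_abs (V r)]
  rw [h.position_eq hs, sub_sub_cancel_left, abs_neg, ← Real.norm_eq_abs]
  refine (intervalIntegral.norm_integral_le_of_norm_le hs.2 (Eventually.of_forall hV)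
    (intervalIntegrable_const.add hi)).trans_eq ?_
  rw [intervalIntegral.integral_add intervalIntegrable_const hi,
    intervalIntegral.integral_const, smul_eq_mul]

lemma abs_sub_le_integral (h : IsTrajectory t γ X V) (hb : IntervalIntegrable b volume 0 t)
    (hγ : ∀ s ∈ Icc 0 t, |γ s| ≤ b s) :
    ∀ s ∈ Icc 0 t, |V s - V t| ≤ ∫ r in 0..t, b r ∧
      |X s - X t| ≤ t * (|V t| + ∫ r in 0..t, b r) := fun s hs => by
  have hb₀ : 0 ≤ᵐ[volume.restrict (Ioc 0 t)] b := by
    filter_upwards [ae_restrict_mem measurableSet_Ioc] with r hr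
    exact (abs_nonneg _).trans (hγ r (Ioc_subset_Icc_self hr))
  have htail : ∀ τ ∈ Icc 0 t, ∫ r in τ..t, b r ≤ ∫ r in 0..t, b r := fun τ hτ =>
    intervalIntegral.integral_mono_interval hτ.1 hτ.2 le_rfl hb₀ hb
  have hV : ∀ τ ∈ Icc 0 t, |V τ - V t| ≤ ∫ r in 0..t, b r := fun τ hτ =>
    (h.abs_velocity_sub_le hb hγ hτ).trans (htail τ hτ)
  refine ⟨hV s hs, ?_⟩
  have ht : t ∈ Icc 0 t := ⟨hs.1.trans hs.2, le_rfl⟩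
  have hX := Convex.norm_image_sub_le_of_norm_hasDerivWithin_le h.position
    (C := |V t| + ∫ r in 0..t, b r) (fun r hr => by
      rw [Real.norm_eq_abs]; linarith [hV r hr, abs_sub_abs_le_abs_sub (V r) (V t)])
    (convex_Icc 0 t) ht hs
  rw [Real.norm_eq_abs, Real.norm_eq_abs, mul_comm] at hX
  refine hX.trans (mul_le_mul_of_nonneg_right
    (abs_le.2 ⟨by linarith [hs.1], by linarith [hs.2, ht.1]⟩) ?_)
  exact add_nonneg (abs_nonneg _) ((abs_nonneg _).trans (hV t ht))

end IsTrajectory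

lemma exists_isTrajectory {t : ℝ} (ht : 0 ≤ t) {G : ℝ → ℝ → ℝ} {L : ℝ≥0} {B : ℝ}
    (hG : ContinuousOn (fun p : ℝ × ℝ => G p.1 p.2) (Icc 0 t ×ˢ univ))
    (hL : ∀ s ∈ Icc 0 t, LipschitzWith L (G s)) (hB : ∀ s ∈ Icc 0 t, ∀ x, |G s x| ≤ B) (x v : ℝ) :
    ∃ X V : ℝ → ℝ, X t = x ∧ V t = v ∧ IsTrajectory t (fun s => G s (X s)) X V := by
  have hB₀ : 0 ≤ B := (abs_nonneg _).trans (hB 0 ⟨le_rfl, ht⟩ 0)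
  set N : ℝ := |v| + B * t
  have hN₀ : 0 ≤ N := by positivity
  have hN : -N ≤ N := by linarith
  -- The field `(V, -G(s, X))` is unbounded, so `V` is clipped at the bound it satisfies a priori.
  let clip (w : ℝ) : ℝ := projIcc (-N) N hN w
  have hclip (w : ℝ) : |clip w| ≤ N := abs_le.2 (projIcc (-N) N hN w).2
  have hclipL : LipschitzWith (1 * 1) clip :=
    (LipschitzWith.subtype_val _).comp (LipschitzWith.projIcc hN)
  obtain ⟨α, hαt, hα⟩ := exists_hasDerivWithinAt_of_lipschitz_of_bound
    (Φ := fun s (p : ℝ × ℝ) => (clip p.2, -G s p.1)) (B := max N B)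
    (fun p => continuousOn_const.prodMk (hG.comp (continuousOn_id.prodMk continuousOn_const)
      fun s hs => ⟨hs, mem_univ p.1⟩).neg)
    (fun s hs => (hclipL.comp LipschitzWith.prod_snd).prodMk
      ((hL s hs).comp LipschitzWith.prod_fst).neg)
    (fun s hs p => max_le_max (hclip _) (by simpa using hB s hs p.1)) (right_mem_Icc.2 ht) (x, v)
  have hV : ∀ s ∈ Icc 0 t, HasDerivWithinAt (fun s => (α s).2) (-G s (α s).1) (Icc 0 t) s :=
    fun s hs => (hα s hs).snd
  have hV_le : ∀ s ∈ Icc 0 t, |(α s).2| ≤ N := fun s hs => by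
    have hdist : |(α s).2 - v| ≤ B * |s - t| := by
      simpa only [hαt, Real.norm_eq_abs] using Convex.norm_image_sub_le_of_norm_hasDerivWithin_le
        hV (fun r hr => by simpa using hB r hr _) (convex_Icc 0 t) (right_mem_Icc.2 ht) hs
    have hst : |s - t| ≤ t := abs_le.2 ⟨by linarith [hs.1], by linarith [hs.2]⟩
    linarith [abs_sub_abs_le_abs_sub (α s).2 v, mul_le_mul_of_nonneg_left hst hB₀]
  have hαc : ContinuousOn α (Icc 0 t) := fun s hs => (hα s hs).continuousWithinAt
  refine ⟨fun s => (α s).1, fun s => (α s).2, by simp only [hαt], by simp only [hαt],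
    hG.comp (continuousOn_id.prodMk hαc.fst) fun s hs => ⟨hs, mem_univ _⟩, fun s hs => ?_, hV⟩
  have hX : HasDerivWithinAt (fun s => (α s).1) (clip (α s).2) (Icc 0 t) s := (hα s hs).fst
  rwa [show clip (α s).2 = (α s).2 by
    simp only [clip, projIcc_of_mem hN (abs_le.1 (hV_le s hs))]] at hX

/-- Projection of the time axis onto `[0, T]`. Composing with it extends functions on
`[0, T] × ℝ²` continuously to all times. -/
noncomputable def clampTime (T s : ℝ) : ℝ := max 0 (min T s)

lemma continuous_clampTime (T : ℝ) : Continuous (clampTime T) := by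
  unfold clampTime; fun_prop

lemma clampTime_mem {T : ℝ} (hT : 0 ≤ T) (s : ℝ) : clampTime T s ∈ Icc 0 T :=
  ⟨le_max_left _ _, max_le hT (min_le_left _ _)⟩

lemma clampTime_of_mem {T s : ℝ} (hs : s ∈ Icc 0 T) : clampTime T s = s := by
  simp [clampTime, hs.1, hs.2]

/-- The derivative of `f`, as a function on `[0, T] × ℝ²`, in the direction `e`. It is extended to
times outside `[0, T]` by its values at the end points. -/
noncomputable def partialDeriv (T : ℝ) (f : ℝ → ℝ → ℝ → ℝ) (e : ℝ × ℝ × ℝ) (s x v : ℝ) : ℝ :=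
  fderivWithin ℝ (fun p : ℝ × ℝ × ℝ => f p.1 p.2.1 p.2.2) (Icc 0 T ×ˢ univ) (clampTime T s, x, v) e

section Regularity

variable {T : ℝ} {f : ℝ → ℝ → ℝ → ℝ}

lemma continuous_clamped (hT : 0 ≤ T)
    (hf : ContDiffOn ℝ 1 (fun p : ℝ × ℝ × ℝ => f p.1 p.2.1 p.2.2) (Icc 0 T ×ˢ univ)) :
    Continuous fun p : ℝ × ℝ × ℝ => f (clampTime T p.1) p.2.1 p.2.2 := by
  have := continuous_clampTime T
  exact hf.continuousOn.comp_continuous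
    (f := fun p : ℝ × ℝ × ℝ => (clampTime T p.1, p.2)) (by fun_prop)
    fun p => ⟨clampTime_mem hT _, mem_univ _⟩

lemma continuous_partialDeriv (hT : 0 < T)
    (hf : ContDiffOn ℝ 1 (fun p : ℝ × ℝ × ℝ => f p.1 p.2.1 p.2.2) (Icc 0 T ×ˢ univ))
    (e : ℝ × ℝ × ℝ) :
    Continuous fun p : ℝ × ℝ × ℝ => partialDeriv T f e p.1 p.2.1 p.2.2 := by
  have := continuous_clampTime T
  have hfderiv := hf.continuousOn_fderivWithin
    ((uniqueDiffOn_Icc hT).prod uniqueDiffOn_univ) le_rfl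
  exact (hfderiv.comp_continuous (f := fun p : ℝ × ℝ × ℝ => (clampTime T p.1, p.2)) (by fun_prop)
    fun p => ⟨clampTime_mem hT.le _, mem_univ _⟩).clm_apply continuous_const

lemma hasFDerivWithinAt_clamped
    (hf : ContDiffOn ℝ 1 (fun p : ℝ × ℝ × ℝ => f p.1 p.2.1 p.2.2) (Icc 0 T ×ˢ univ))
    {s : ℝ} (hs : s ∈ Icc 0 T) (x v : ℝ) :
    HasFDerivWithinAt (fun p : ℝ × ℝ × ℝ => f p.1 p.2.1 p.2.2)
      (fderivWithin ℝ (fun p : ℝ × ℝ × ℝ => f p.1 p.2.1 p.2.2) (Icc 0 T ×ˢ univ)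
        (clampTime T s, x, v)) (Icc 0 T ×ˢ univ) (s, x, v) := by
  rw [clampTime_of_mem hs]
  exact (hf.differentiableOn one_ne_zero _ ⟨hs, mem_univ _⟩).hasFDerivWithinAt

lemma hasDerivWithinAt_along
    (hf : ContDiffOn ℝ 1 (fun p : ℝ × ℝ × ℝ => f p.1 p.2.1 p.2.2) (Icc 0 T ×ˢ univ))
    {t s x' v' : ℝ} {X V : ℝ → ℝ} (ht : t ≤ T) (hs : s ∈ Icc 0 t)
    (hX : HasDerivWithinAt X x' (Icc 0 t) s) (hV : HasDerivWithinAt V v' (Icc 0 t) s) :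
    HasDerivWithinAt (fun r => f r (X r) (V r))
      (partialDeriv T f (1, 0, 0) s (X s) (V s) + x' * partialDeriv T f (0, 1, 0) s (X s) (V s)
        + v' * partialDeriv T f (0, 0, 1) s (X s) (V s)) (Icc 0 t) s := by
  have h := (hasFDerivWithinAt_clamped hf ⟨hs.1, hs.2.trans ht⟩ (X s) (V s)).comp_hasDerivWithinAt
    (f := fun r => (r, X r, V r)) s ((hasDerivWithinAt_id s _).prodMk (hX.prodMk hV))
    (fun r hr => ⟨⟨hr.1, hr.2.trans ht⟩, mem_univ _⟩)
  convert! h using 1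
  have hdir : ((1 : ℝ), x', v') = (1, 0, 0) + x' • ((0 : ℝ), (1 : ℝ), (0 : ℝ)) +
      v' • ((0 : ℝ), (0 : ℝ), (1 : ℝ)) := by simp
  rw [hdir, map_add, map_add, map_smul, map_smul]
  rfl

lemma hasDerivAt_position
    (hf : ContDiffOn ℝ 1 (fun p : ℝ × ℝ × ℝ => f p.1 p.2.1 p.2.2) (Icc 0 T ×ˢ univ))
    {s : ℝ} (hs : s ∈ Icc 0 T) (x v : ℝ) :
    HasDerivAt (fun y => f s y v) (partialDeriv T f (0, 1, 0) s x v) x :=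
  (hasFDerivWithinAt_clamped hf hs x v).comp_hasDerivAt (f := fun y => (s, y, v)) x
    ((hasDerivAt_const x s).prodMk ((hasDerivAt_id x).prodMk (hasDerivAt_const x v)))
    (Eventually.of_forall fun _ => ⟨hs, mem_univ _⟩)

lemma hasDerivAt_velocity
    (hf : ContDiffOn ℝ 1 (fun p : ℝ × ℝ × ℝ => f p.1 p.2.1 p.2.2) (Icc 0 T ×ˢ univ))
    {s : ℝ} (hs : s ∈ Icc 0 T) (x v : ℝ) :
    HasDerivAt (fun w => f s x w) (partialDeriv T f (0, 0, 1) s x v) v :=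
  (hasFDerivWithinAt_clamped hf hs x v).comp_hasDerivAt (f := fun w => (s, x, w)) v
    ((hasDerivAt_const v s).prodMk ((hasDerivAt_const v x).prodMk (hasDerivAt_id v)))
    (Eventually.of_forall fun _ => ⟨hs, mem_univ _⟩)

lemma hasDerivWithinAt_time
    (hf : ContDiffOn ℝ 1 (fun p : ℝ × ℝ × ℝ => f p.1 p.2.1 p.2.2) (Icc 0 T ×ˢ univ))
    {s : ℝ} (hs : s ∈ Icc 0 T) (x v : ℝ) :
    HasDerivWithinAt (fun r => f r x v) (partialDeriv T f (1, 0, 0) s x v) (Icc 0 T) s := by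
  simpa using hasDerivWithinAt_along hf le_rfl hs (hasDerivWithinAt_const s (Icc 0 T) x)
    (hasDerivWithinAt_const s (Icc 0 T) v)

end Regularity

section Field

variable {F : ℝ → ℝ} {f : ℝ → ℝ → ℝ → ℝ} {t : ℝ}

/-- Half of the total charge; it is the limit of the electric field at `+∞`, and minus its limit
at `-∞`. -/
noncomputable def halfCharge (F : ℝ → ℝ) (f : ℝ → ℝ → ℝ → ℝ) (t : ℝ) : ℝ :=
  (1 / 2) * ∫ y, chargeDensity F f t y

lemma electricField_eq_integral_Iic_sub (h : Integrable fun y => chargeDensity F f t y) (x : ℝ) :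
    electricField F f t x = (∫ y in Iic x, chargeDensity F f t y) - halfCharge F f t := by
  unfold electricField halfCharge
  rw [← intervalIntegral.integral_Iic_add_Ioi (b := x) h.integrableOn h.integrableOn]
  ring

lemma electricField_eq_sub_integral_Ioi (h : Integrable fun y => chargeDensity F f t y) (x : ℝ) :
    electricField F f t x = halfCharge F f t - ∫ y in Ioi x, chargeDensity F f t y := by
  unfold electricField halfCharge
  rw [← intervalIntegral.integral_Iic_add_Ioi (b := x) h.integrableOn h.integrableOn]
  ring

lemma electricField_sub (h : Integrable fun y => chargeDensity F f t y) (x y : ℝ) :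
    electricField F f t x - electricField F f t y = ∫ z in y..x, chargeDensity F f t z := by
  rw [electricField_eq_integral_Iic_sub h, electricField_eq_integral_Iic_sub h,
    ← intervalIntegral.integral_Iic_sub_Iic h.integrableOn h.integrableOn]
  ring

lemma continuous_electricField (h : Integrable fun y => chargeDensity F f t y) :
    Continuous (electricField F f t) := by
  have hE : electricField F f t = fun x =>
      electricField F f t 0 + ∫ z in 0..x, chargeDensity F f t z :=
    funext fun x => by rw [← electricField_sub h]; ring
  rw [hE]
  exact continuous_const.add
    (intervalIntegral.continuous_primitive (fun _ _ => h.intervalIntegrable) 0)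

lemma bddAbove_abs_electricField (h : Integrable fun y => chargeDensity F f t y) :
    BddAbove (range fun x => |electricField F f t x|) := by
  refine ⟨(∫ y, |chargeDensity F f t y|) + |halfCharge F f t|, ?_⟩
  rintro _ ⟨x, rfl⟩
  dsimp only
  rw [electricField_eq_integral_Iic_sub h]
  exact (abs_sub _ _).trans (add_le_add_left (abs_integral_le_integral_abs.trans
    (setIntegral_le_integral h.abs (Eventually.of_forall fun _ => abs_nonneg _))) _)

lemma abs_electricField_le (h : Integrable fun y => chargeDensity F f t y) (x : ℝ) :
    |electricField F f t x| ≤ fieldSupNorm F f t :=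
  le_ciSup (bddAbove_abs_electricField h) x

lemma fieldSupNorm_nonneg (F : ℝ → ℝ) (f : ℝ → ℝ → ℝ → ℝ) (t : ℝ) : 0 ≤ fieldSupNorm F f t :=
  Real.iSup_nonneg fun _ => abs_nonneg _

end Field

namespace IsC1Solution

variable {T : ℝ} {F : ℝ → ℝ} {f₀ : ℝ → ℝ → ℝ} {f : ℝ → ℝ → ℝ → ℝ}

lemma vlasov_partialDeriv (hf : IsC1Solution T F f₀ f) (hT : 0 < T) {s : ℝ}
    (hs : s ∈ Icc 0 T) (x v : ℝ) :
    partialDeriv T f (1, 0, 0) s x v + v * partialDeriv T f (0, 1, 0) s x v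
      - electricField F f s x * partialDeriv T f (0, 0, 1) s x v = 0 := by
  have h := hf.vlasov s hs x v
  rwa [(hasDerivWithinAt_time hf.contDiffOn hs x v).derivWithin (uniqueDiffOn_Icc hT s hs),
    (hasDerivAt_position hf.contDiffOn hs x v).deriv,
    (hasDerivAt_velocity hf.contDiffOn hs x v).deriv] at h

lemma hasDerivWithinAt_trajectory (hf : IsC1Solution T F f₀ f) (hT : 0 < T) {t : ℝ}
    (ht : t ≤ T) {γ X V : ℝ → ℝ} (h : IsTrajectory t γ X V) {s : ℝ} (hs : s ∈ Icc 0 t) :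
    HasDerivWithinAt (fun r => f r (X r) (V r))
      ((electricField F f s (X s) - γ s) * partialDeriv T f (0, 0, 1) s (X s) (V s))
      (Icc 0 t) s := by
  convert! hasDerivWithinAt_along hf.contDiffOn ht hs (h.position s hs) (h.velocity s hs) using 1
  linarith [hf.vlasov_partialDeriv hT ⟨hs.1, hs.2.trans ht⟩ (X s) (V s)]

lemma abs_sub_initial_le_of_trajectory (hf : IsC1Solution T F f₀ f) (hT : 0 < T) {t : ℝ}
    (ht : t ∈ Icc 0 T) {γ X V : ℝ → ℝ} (h : IsTrajectory t γ X V) {w : ℝ → ℝ} {C : ℝ}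
    (hw : IntervalIntegrable w volume 0 t)
    (hγ : ∀ s ∈ Icc 0 t, |electricField F f s (X s) - γ s| ≤ w s)
    (hC : ∀ s ∈ Icc 0 t, |partialDeriv T f (0, 0, 1) s (X s) (V s)| ≤ C) :
    |f t (X t) (V t) - f₀ (X 0) (V 0)| ≤ C * ∫ s in 0..t, w s := by
  have hcont : ContinuousOn (fun s =>
      (electricField F f s (X s) - γ s) * partialDeriv T f (0, 0, 1) s (X s) (V s)) (Icc 0 t) := by
    have hD (e : ℝ × ℝ × ℝ) : ContinuousOn (fun s => partialDeriv T f e s (X s) (V s)) (Icc 0 t) :=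
      (continuous_partialDeriv hT hf.contDiffOn e).comp_continuousOn
        (continuousOn_id.prodMk (h.continuousOn_position.prodMk h.continuousOn_velocity))
    refine (((hD (1, 0, 0)).add (h.continuousOn_velocity.mul (hD (0, 1, 0)))).sub
      (h.continuousOn.mul (hD (0, 0, 1)))).congr fun s hs => ?_
    simp only [Pi.add_apply, Pi.mul_apply, Pi.sub_apply]
    linarith [hf.vlasov_partialDeriv hT ⟨hs.1, hs.2.trans ht.2⟩ (X s) (V s)]
  rw [← hf.initial, ← integral_eq_sub_of_hasDerivWithinAt_Icc
    (fun s hs => hf.hasDerivWithinAt_trajectory hT ht.2 h hs) hcont ⟨le_rfl, ht.1⟩ ⟨ht.1, le_rfl⟩,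
    ← Real.norm_eq_abs, ← intervalIntegral.integral_const_mul]
  refine intervalIntegral.norm_integral_le_of_norm_le ht.1
    (Eventually.of_forall fun s hs => ?_) (hw.const_mul C)
  have hs' := Ioc_subset_Icc_self hs
  rw [Real.norm_eq_abs, abs_mul, mul_comm]
  exact mul_le_mul (hC s hs') (hγ s hs') (abs_nonneg _) ((abs_nonneg _).trans (hC s hs'))

lemma measurable_electricField (hf : IsC1Solution T F f₀ f) (hT : 0 ≤ T)
    (hF : Continuous F) (x : ℝ) : Measurable fun s => electricField F f (clampTime T s) x := by
  have hg : StronglyMeasurable fun q : (ℝ × ℝ) × ℝ => F q.2 - f (clampTime T q.1.1) q.1.2 q.2 :=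
    ((hF.comp continuous_snd).sub ((continuous_clamped hT hf.contDiffOn).comp
      (by fun_prop : Continuous fun q : (ℝ × ℝ) × ℝ => (q.1.1, q.1.2, q.2)))).stronglyMeasurable
  have hρ : StronglyMeasurable fun q : ℝ × ℝ => chargeDensity F f (clampTime T q.1) q.2 :=
    hg.integral_prod_right'
  have hint (S : Set ℝ) : StronglyMeasurable
      fun s => ∫ y in S, chargeDensity F f (clampTime T s) y :=
    hρ.integral_prod_right'
  exact (((hint (Iic x)).sub (hint (Ioi x))).const_mul (1 / 2)).measurable

lemma exists_isTrajectory_near (hf : IsC1Solution T F f₀ f) (hF : Continuous F)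
    (he : IntervalIntegrable (fieldSupNorm F f) volume 0 T) {t : ℝ} (ht : t ∈ Icc 0 T) (x v : ℝ)
    {ε : ℝ} (hε : 0 < ε) :
    ∃ γ X V w, IsTrajectory t γ X V ∧ X t = x ∧ V t = v ∧
      IntervalIntegrable w volume 0 t ∧ ∫ s in 0..t, w s ≤ ε ∧
      ∀ s ∈ Icc 0 t, |electricField F f s (X s) - γ s| ≤ w s ∧
        |V s - v| ≤ (∫ s in 0..t, fieldSupNorm F f s) + ε ∧
        |X s - x| ≤ t * (|v| + ((∫ s in 0..t, fieldSupNorm F f s) + ε)) := by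
  have hT : 0 ≤ T := ht.1.trans ht.2
  have hsub : Icc 0 t ⊆ Icc 0 T := Icc_subset_Icc_right ht.2
  have het : IntervalIntegrable (fieldSupNorm F f) volume 0 t :=
    he.mono_set (uIcc_subset_uIcc_left (by rwa [uIcc_of_le hT]))
  have hΦ : 0 ≤ ∫ s in 0..t, fieldSupNorm F f s :=
    intervalIntegral.integral_nonneg ht.1 fun s _ => fieldSupNorm_nonneg F f s
  set N := (∫ s in 0..t, fieldSupNorm F f s) + ε
  have hK : 0 ≤ |x| + t * (|v| + N) := by have := ht.1; positivity
  let E (s : ℝ) : C(ℝ, ℝ) := ⟨electricField F f (clampTime T s),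
    continuous_electricField (hf.integrable_density _ (clampTime_mem hT s))⟩
  have hE : ∀ s ∈ Icc 0 t, ∀ y, E s y = electricField F f s y := fun s hs y => by
    simp only [E, ContinuousMap.coe_mk, clampTime_of_mem (hsub hs)]
  obtain ⟨G, ⟨L, hL⟩, ⟨B, hB⟩, w, hw, hwε, hwG⟩ := exists_lipschitz_integral_approx (E := E) ht.1 hK
    het (hf.measurable_electricField hT hF)
    (fun s hs y => hE s hs y ▸ abs_electricField_le (hf.integrable_density s (hsub hs)) y) hε
  obtain ⟨X, V, rfl, rfl, htraj⟩ := exists_isTrajectory ht.1 (G := fun s y => G (s, y))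
    hL.continuous.continuousOn (fun s _ => hL.comp (LipschitzWith.prodMk_left s))
    (fun s _ y => hB (s, y)) x v
  have hVX := htraj.abs_sub_le_integral (het.add hw) fun s hs => (hwG s hs).2 _
  rw [intervalIntegral.integral_add het hw] at hVX
  have hV : ∀ s ∈ Icc 0 t, |V s - V t| ≤ N := fun s hs => (hVX s hs).1.trans (by linarith)
  have hX : ∀ s ∈ Icc 0 t, |X s - X t| ≤ t * (|V t| + N) := fun s hs => (hVX s hs).2.trans
    (mul_le_mul_of_nonneg_left (by linarith) ht.1)
  refine ⟨_, X, V, w, htraj, rfl, rfl, hw, hwε, fun s hs => ⟨?_, hV s hs, hX s hs⟩⟩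
  rw [← hE s hs]
  exact (hwG s hs).1 _ (by linarith [hX s hs, abs_sub_abs_le_abs_sub (X s) (X t)])

lemma exists_initial_near (hf : IsC1Solution T F f₀ f) (hT : 0 < T)
    (hF : Continuous F) (he : IntervalIntegrable (fieldSupNorm F f) volume 0 T) {t : ℝ}
    (ht : t ∈ Icc 0 T) (x v : ℝ) {ε : ℝ} (hε : 0 < ε) :
    ∃ x' v', |v' - v| ≤ (∫ s in 0..t, fieldSupNorm F f s) + 1 ∧ |f t x v - f₀ x' v'| ≤ ε := by
  set N := (∫ s in 0..t, fieldSupNorm F f s) + 1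
  set K := t * (|v| + N)
  obtain ⟨C, hC⟩ := (isCompact_Icc.prod (isCompact_Icc.prod isCompact_Icc) : IsCompact
    (Icc 0 t ×ˢ Icc (x - K) (x + K) ×ˢ Icc (v - N) (v + N))).exists_bound_of_continuousOn
    (continuous_partialDeriv hT hf.contDiffOn (0, 0, 1)).continuousOn
  have hC₀ : 0 < max C 1 := one_pos.trans_le (le_max_right _ _)
  obtain ⟨γ, X, V, w, htraj, rfl, rfl, hw, hwε, hnear⟩ :=
    hf.exists_isTrajectory_near hF he ht x v (ε := min 1 (ε / max C 1)) (by positivity)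
  have hV : ∀ s ∈ Icc 0 t, |V s - V t| ≤ N := fun s hs =>
    (hnear s hs).2.1.trans (add_le_add_right (min_le_left _ _) _)
  have hX : ∀ s ∈ Icc 0 t, |X s - X t| ≤ K := fun s hs => (hnear s hs).2.2.trans
    (mul_le_mul_of_nonneg_left (by linarith [min_le_left 1 (ε / max C 1)]) ht.1)
  refine ⟨X 0, V 0, hV 0 ⟨le_rfl, ht.1⟩, ?_⟩
  calc |f t (X t) (V t) - f₀ (X 0) (V 0)|
    _ ≤ max C 1 * ∫ s in 0..t, w s :=
        hf.abs_sub_initial_le_of_trajectory hT ht htraj hw (fun s hs => (hnear s hs).1)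
          fun s hs => (hC (s, X s, V s) ⟨hs, mem_Icc_iff_abs_le.1 (abs_sub_comm (X s) _ ▸ hX s hs),
            mem_Icc_iff_abs_le.1 (abs_sub_comm (V s) _ ▸ hV s hs)⟩).trans (le_max_left _ _)
    _ ≤ max C 1 * (ε / max C 1) := by gcongr; exact hwε.trans (min_le_right _ _)
    _ = ε := mul_div_cancel₀ _ hC₀.ne'

end IsC1Solution

/-- A `C¹` solution that is bounded by `B`, along with the background, and has no particles of
speed at least `P`. -/
structure IsBoundedSolution (T B P : ℝ) (F : ℝ → ℝ) (f₀ : ℝ → ℝ → ℝ) (f : ℝ → ℝ → ℝ → ℝ) : Prop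
    extends IsC1Solution T F f₀ f where
  time_pos : 0 < T
  velocity_pos : 0 < P
  background_contDiff : ContDiff ℝ 1 F
  background_abs_le : ∀ v, |F v| ≤ B
  background_eq_zero : ∀ v, P ≤ |v| → F v = 0
  protected abs_le : ∀ t ∈ Icc 0 T, ∀ x v, |f t x v| ≤ B
  protected eq_zero : ∀ t ∈ Icc 0 T, ∀ x v, P ≤ |v| → f t x v = 0

lemma initial_abs_add_one {R : ℝ} {F : ℝ → ℝ} {f₀ : ℝ → ℝ → ℝ}
    (hfar : ∀ x v, R < |x| → f₀ x v = F v) (v : ℝ) : f₀ (|R| + 1) v = F v :=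
  hfar _ _ (lt_of_lt_of_le (by linarith [le_abs_self R]) (le_abs_self _))

namespace IsC1Solution

variable {T R : ℝ} {F : ℝ → ℝ} {f₀ : ℝ → ℝ → ℝ} {f : ℝ → ℝ → ℝ → ℝ}

lemma contDiff_initial (hf : IsC1Solution T F f₀ f) (hT : 0 ≤ T) :
    ContDiff ℝ 1 fun p : ℝ × ℝ => f₀ p.1 p.2 := by
  simpa only [Function.comp_def, hf.initial] using hf.contDiffOn.comp_contDiff
    (by fun_prop : ContDiff ℝ 1 fun p : ℝ × ℝ => ((0 : ℝ), p)) fun p => ⟨⟨le_rfl, hT⟩, mem_univ _⟩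

lemma contDiff_background (hf : IsC1Solution T F f₀ f) (hT : 0 ≤ T)
    (hfar : ∀ x v, R < |x| → f₀ x v = F v) : ContDiff ℝ 1 F := by
  simpa only [Function.comp_def, initial_abs_add_one hfar] using (hf.contDiff_initial hT).comp
    (by fun_prop : ContDiff ℝ 1 fun v : ℝ => (|R| + 1, v))

end IsC1Solution

lemma background_eq_zero_of_initial {R P : ℝ} {F : ℝ → ℝ} {f₀ : ℝ → ℝ → ℝ}
    (hfar : ∀ x v, R < |x| → f₀ x v = F v) (hP : ∀ x v, P < |v| → f₀ x v = 0) {v : ℝ}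
    (hv : P < |v|) : F v = 0 := by
  rw [← initial_abs_add_one hfar v, hP _ v hv]

lemma exists_forall_abs_initial_le {R P : ℝ} {F : ℝ → ℝ} {f₀ : ℝ → ℝ → ℝ}
    (hc : Continuous fun p : ℝ × ℝ => f₀ p.1 p.2) (hfar : ∀ x v, R < |x| → f₀ x v = F v)
    (hP : ∀ x v, P < |v| → f₀ x v = 0) : ∃ B, ∀ x v, |f₀ x v| ≤ B := by
  obtain ⟨B, hB⟩ := ((isCompact_Icc (a := -(|R| + 1)) (b := |R| + 1)).prod
    (isCompact_Icc (a := -P) (b := P))).exists_bound_of_continuousOn hc.continuousOn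
  have hB' : ∀ x v, |x| ≤ |R| + 1 → |v| ≤ P → |f₀ x v| ≤ B := fun x v hx hv =>
    hB (x, v) ⟨abs_le.1 hx, abs_le.1 hv⟩
  refine ⟨max B 0, fun x v => ?_⟩
  rcases lt_or_ge P |v| with hv | hv
  · rw [hP x v hv, abs_zero]
    exact le_max_right _ _
  refine le_trans ?_ (le_max_left B 0)
  rcases le_or_gt |x| (|R| + 1) with hx | hx
  · exact hB' x v hx hv
  · rw [hfar x v (by linarith [le_abs_self R]), ← initial_abs_add_one hfar v]
    exact hB' _ v (abs_of_pos (by positivity)).le hv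

lemma IsC1Solution.exists_isBoundedSolution {T R : ℝ} {F : ℝ → ℝ} {f₀ : ℝ → ℝ → ℝ}
    {f : ℝ → ℝ → ℝ → ℝ} (hf : IsC1Solution T F f₀ f) (hT : 0 < T)
    (hfar : ∀ x v, R < |x| → f₀ x v = F v) (hsupp : ∃ P, ∀ x v, P < |v| → f₀ x v = 0)
    (he : IntervalIntegrable (fieldSupNorm F f) volume 0 T) :
    ∃ B P, IsBoundedSolution T B P F f₀ f := by
  obtain ⟨P, hP⟩ := hsupp
  have hFC := hf.contDiff_background hT.le hfar
  obtain ⟨B, hB⟩ := exists_forall_abs_initial_le (hf.contDiff_initial hT.le).continuous hfar hP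
  set Φ := ∫ s in 0..T, fieldSupNorm F f s
  have hΦ : 0 ≤ Φ := intervalIntegral.integral_nonneg hT.le fun s _ => fieldSupNorm_nonneg F f s
  have hnear : ∀ t ∈ Icc 0 T, ∀ x v ε, 0 < ε →
      ∃ x' v', |v' - v| ≤ Φ + 1 ∧ |f t x v - f₀ x' v'| ≤ ε := fun t ht x v ε hε => by
    obtain ⟨x', v', hv, hε'⟩ := hf.exists_initial_near hT hFC.continuous he ht x v hε
    have hmono : ∫ s in 0..t, fieldSupNorm F f s ≤ Φ :=
      intervalIntegral.integral_mono_interval le_rfl ht.1 ht.2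
        (Eventually.of_forall fun s => fieldSupNorm_nonneg F f s) he
    exact ⟨x', v', by linarith, hε'⟩
  refine ⟨B, |P| + Φ + 2, hf, hT, by positivity, hFC, fun v => ?_, fun v hv =>
    background_eq_zero_of_initial hfar hP (by linarith [le_abs_self P]), fun t ht x v =>
    le_of_forall_pos_le_add fun ε hε => ?_, fun t ht x v hv => abs_eq_zero.1 (le_antisymm
    (le_of_forall_pos_le_add fun ε hε => ?_) (abs_nonneg _))⟩
  · rw [← initial_abs_add_one hfar v]
    exact hB _ v
  · obtain ⟨x', v', -, hε'⟩ := hnear t ht x v ε hε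
    linarith [hB x' v', abs_sub_abs_le_abs_sub (f t x v) (f₀ x' v')]
  · obtain ⟨x', v', hv', hε'⟩ := hnear t ht x v ε hε
    have hPv' : P < |v'| := by
      linarith [le_abs_self P, abs_sub_abs_le_abs_sub v v', abs_sub_comm v v']
    rwa [hP x' v' hPv', sub_zero, ← zero_add ε] at hε'

/-- The momentum density `∫ v f(t,x,v) dv`, which is the flux of `-ρ`. -/
noncomputable def momentum (f : ℝ → ℝ → ℝ → ℝ) (t x : ℝ) : ℝ := ∫ v, v * f t x v

lemma integral_swap_of_continuous {u : ℝ → ℝ → ℝ} (hu : Continuous fun p : ℝ × ℝ => u p.1 p.2)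
    (a b c d : ℝ) :
    ∫ x in a..b, ∫ y in c..d, u x y = ∫ y in c..d, ∫ x in a..b, u x y :=
  intervalIntegral_intervalIntegral_swap <| (hu.continuousOn.integrableOn_compact
    (isCompact_uIcc.prod isCompact_uIcc)).mono_set (prod_mono uIoc_subset_uIcc uIoc_subset_uIcc)

lemma integral_eq_of_eq_zero {P : ℝ} {u : ℝ → ℝ} (hu : ∀ v, P ≤ |v| → u v = 0) :
    ∫ v, u v = ∫ v in -P..P, u v := by
  refine (intervalIntegral.integral_eq_integral_of_support_subset fun v hv => ?_).symm
  have hlt : |v| < P := not_le.1 fun h => hv (hu v h)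
  exact ⟨(abs_lt.1 hlt).1, (abs_lt.1 hlt).2.le⟩

lemma abs_integral_mul_le {P C : ℝ} (hP : 0 ≤ P) {u : ℝ → ℝ} (hu : ∀ v, |u v| ≤ C) :
    |∫ v in -P..P, v * u v| ≤ 2 * P ^ 2 * C := by
  have h := intervalIntegral.norm_integral_le_of_norm_le_const (a := -P) (b := P) (C := P * C)
    (f := fun v => v * u v) fun v hv => by
      rw [uIoc_of_le (by linarith)] at hv
      rw [norm_mul]
      exact mul_le_mul (abs_le.2 ⟨hv.1.le, hv.2⟩) (hu v) (abs_nonneg _) hP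
  rw [sub_neg_eq_add, abs_of_nonneg (by linarith)] at h
  exact h.trans_eq (by ring)

namespace IsBoundedSolution

variable {T B P : ℝ} {F : ℝ → ℝ} {f₀ : ℝ → ℝ → ℝ} {f : ℝ → ℝ → ℝ → ℝ}

lemma bound_nonneg (hf : IsBoundedSolution T B P F f₀ f) : 0 ≤ B :=
  (abs_nonneg _).trans (hf.background_abs_le 0)

lemma chargeDensity_eq (hf : IsBoundedSolution T B P F f₀ f) {t : ℝ} (ht : t ∈ Icc 0 T) (x : ℝ) :
    chargeDensity F f t x = ∫ v in -P..P, (F v - f t x v) :=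
  integral_eq_of_eq_zero fun v hv => by
    rw [hf.background_eq_zero v hv, hf.eq_zero t ht x v hv, sub_zero]

lemma momentum_eq (hf : IsBoundedSolution T B P F f₀ f) {t : ℝ} (ht : t ∈ Icc 0 T) (x : ℝ) :
    momentum f t x = ∫ v in -P..P, v * f t x v :=
  integral_eq_of_eq_zero fun v hv => by rw [hf.eq_zero t ht x v hv, mul_zero]

lemma abs_chargeDensity_le (hf : IsBoundedSolution T B P F f₀ f) {t : ℝ} (ht : t ∈ Icc 0 T)
    (x : ℝ) : |chargeDensity F f t x| ≤ 4 * B * P := by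
  have h := intervalIntegral.norm_integral_le_of_norm_le_const (a := -P) (b := P) (C := 2 * B)
    (f := fun v => F v - f t x v)
    fun v _ => (abs_sub _ _).trans (by linarith [hf.background_abs_le v, hf.abs_le t ht x v])
  rw [sub_neg_eq_add, abs_of_pos (by linarith [hf.velocity_pos]), ← hf.chargeDensity_eq ht] at h
  exact h.trans_eq (by ring)

lemma abs_momentum_le (hf : IsBoundedSolution T B P F f₀ f) {t : ℝ} (ht : t ∈ Icc 0 T) (x : ℝ) :
    |momentum f t x| ≤ 2 * P ^ 2 * B := by
  rw [hf.momentum_eq ht]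
  exact abs_integral_mul_le hf.velocity_pos.le (hf.abs_le t ht x)

lemma continuous_slice (hf : IsBoundedSolution T B P F f₀ f) {t : ℝ} (ht : t ∈ Icc 0 T) (x : ℝ) :
    Continuous (f t x) := by
  have h := (continuous_clamped hf.time_pos.le hf.contDiffOn).comp
    (by fun_prop : Continuous fun v : ℝ => (t, x, v))
  simpa only [Function.comp_def, clampTime_of_mem ht] using h

lemma continuous_chargeDensity (hf : IsBoundedSolution T B P F f₀ f) {t : ℝ} (ht : t ∈ Icc 0 T) :
    Continuous fun x => chargeDensity F f t x := by
  have hc : Continuous (Function.uncurry fun x v : ℝ => F v - f (clampTime T t) x v) :=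
    (hf.background_contDiff.continuous.comp continuous_snd).sub
      ((continuous_clamped hf.time_pos.le hf.contDiffOn).comp
        (by fun_prop : Continuous fun q : ℝ × ℝ => (t, q.1, q.2)))
  simpa only [hf.chargeDensity_eq ht, clampTime_of_mem ht] using
    intervalIntegral.continuous_parametric_intervalIntegral_of_continuous' (μ := volume) hc (-P) P

lemma continuousOn_momentum (hf : IsBoundedSolution T B P F f₀ f) (x : ℝ) :
    ContinuousOn (fun s => momentum f s x) (Icc 0 T) := by
  have hc : Continuous (Function.uncurry fun s v : ℝ => v * f (clampTime T s) x v) :=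
    continuous_snd.mul ((continuous_clamped hf.time_pos.le hf.contDiffOn).comp
      (by fun_prop : Continuous fun q : ℝ × ℝ => (q.1, x, q.2)))
  refine (intervalIntegral.continuous_parametric_intervalIntegral_of_continuous' (μ := volume)
    hc (-P) P).continuousOn.congr fun s hs => ?_
  simp only [hf.momentum_eq hs, clampTime_of_mem hs]

lemma intervalIntegrable_momentum (hf : IsBoundedSolution T B P F f₀ f) (x : ℝ) {r t : ℝ}
    (hr : r ∈ Icc 0 T) (ht : t ∈ Icc 0 T) :
    IntervalIntegrable (fun s => momentum f s x) volume r t :=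
  ((hf.continuousOn_momentum x).mono (uIcc_subset_Icc hr ht)).intervalIntegrable

lemma integral_time_partialDeriv (hf : IsBoundedSolution T B P F f₀ f) {s : ℝ}
    (hs : s ∈ Icc 0 T) (x : ℝ) :
    ∫ v in -P..P, partialDeriv T f (1, 0, 0) s x v
      = - ∫ v in -P..P, v * partialDeriv T f (0, 1, 0) s x v := by
  have hc (e : ℝ × ℝ × ℝ) : Continuous fun v => partialDeriv T f e s x v :=
    (continuous_partialDeriv hf.time_pos hf.contDiffOn e).comp
      (by fun_prop : Continuous fun v : ℝ => (s, x, v))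
  have hforce : ∫ v in -P..P, partialDeriv T f (0, 0, 1) s x v = 0 := by
    rw [intervalIntegral.integral_eq_sub_of_hasDerivAt
      (fun v _ => hasDerivAt_velocity hf.contDiffOn hs x v) ((hc _).intervalIntegrable _ _),
      hf.eq_zero s hs x P (le_abs_self P),
      hf.eq_zero s hs x (-P) (by rw [abs_neg]; exact le_abs_self P), sub_zero]
  have hvlasov (v : ℝ) : partialDeriv T f (1, 0, 0) s x v = electricField F f s x *
      partialDeriv T f (0, 0, 1) s x v - v * partialDeriv T f (0, 1, 0) s x v := by
    linarith [hf.vlasov_partialDeriv hf.time_pos hs x v]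
  simp_rw [hvlasov]
  rw [intervalIntegral.integral_sub (((hc _).const_mul _).intervalIntegrable _ _)
    (Continuous.intervalIntegrable (by fun_prop) _ _), intervalIntegral.integral_const_mul,
    hforce, mul_zero, zero_sub]

lemma chargeDensity_time_sub (hf : IsBoundedSolution T B P F f₀ f) {r t : ℝ}
    (hr : r ∈ Icc 0 T) (ht : t ∈ Icc 0 T) (x : ℝ) :
    chargeDensity F f t x - chargeDensity F f r x
      = ∫ s in r..t, ∫ v in -P..P, v * partialDeriv T f (0, 1, 0) s x v := by
  have hc := continuous_partialDeriv hf.time_pos hf.contDiffOn (1, 0, 0)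
  have hi {s : ℝ} (hs : s ∈ Icc 0 T) :
      IntervalIntegrable (fun v => F v - f s x v) volume (-P) P :=
    (hf.background_contDiff.continuous.sub (hf.continuous_slice hs x)).intervalIntegrable _ _
  have htime (v : ℝ) : F v - f t x v - (F v - f r x v)
      = ∫ s in r..t, -partialDeriv T f (1, 0, 0) s x v := by
    rw [intervalIntegral.integral_neg, integral_eq_sub_of_hasDerivWithinAt_Icc
      (fun s hs => hasDerivWithinAt_time hf.contDiffOn hs x v)
      (hc.comp (by fun_prop : Continuous fun s : ℝ => (s, x, v))).continuousOn hr ht]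
    ring
  rw [hf.chargeDensity_eq ht, hf.chargeDensity_eq hr,
    ← intervalIntegral.integral_sub (hi ht) (hi hr)]
  simp_rw [htime]
  rw [integral_swap_of_continuous
    (hc.neg.comp (by fun_prop : Continuous fun p : ℝ × ℝ => (p.2, x, p.1)))]
  refine intervalIntegral.integral_congr fun s hs => ?_
  simp only [intervalIntegral.integral_neg,
    hf.integral_time_partialDeriv (uIcc_subset_Icc hr ht hs), neg_neg]

lemma momentum_sub (hf : IsBoundedSolution T B P F f₀ f) {s : ℝ} (hs : s ∈ Icc 0 T) (a b : ℝ) :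
    momentum f s b - momentum f s a
      = ∫ y in a..b, ∫ v in -P..P, v * partialDeriv T f (0, 1, 0) s y v := by
  have hc := continuous_partialDeriv hf.time_pos hf.contDiffOn (0, 1, 0)
  have hi (y : ℝ) : IntervalIntegrable (fun v => v * f s y v) volume (-P) P :=
    (continuous_id.mul (hf.continuous_slice hs y)).intervalIntegrable _ _
  rw [hf.momentum_eq hs, hf.momentum_eq hs, ← intervalIntegral.integral_sub (hi b) (hi a),
    integral_swap_of_continuous (continuous_snd.mul
      (hc.comp (by fun_prop : Continuous fun p : ℝ × ℝ => (s, p.1, p.2))))]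
  refine intervalIntegral.integral_congr fun v _ => ?_
  rw [intervalIntegral.integral_const_mul, intervalIntegral.integral_eq_sub_of_hasDerivAt
    (fun y _ => hasDerivAt_position hf.contDiffOn hs y v)
    ((hc.comp (by fun_prop : Continuous fun y : ℝ => (s, y, v))).intervalIntegrable _ _), mul_sub]

lemma charge_balance (hf : IsBoundedSolution T B P F f₀ f) {r t : ℝ} (hr : r ∈ Icc 0 T)
    (ht : t ∈ Icc 0 T) (a b : ℝ) :
    (∫ y in a..b, chargeDensity F f t y) - ∫ y in a..b, chargeDensity F f r y
      = (∫ s in r..t, momentum f s b) - ∫ s in r..t, momentum f s a := by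
  have hc : Continuous (Function.uncurry fun (p : ℝ × ℝ) (v : ℝ) =>
      v * partialDeriv T f (0, 1, 0) p.2 p.1 v) :=
    continuous_snd.mul ((continuous_partialDeriv hf.time_pos hf.contDiffOn (0, 1, 0)).comp
      (by fun_prop : Continuous fun q : (ℝ × ℝ) × ℝ => (q.1.2, q.1.1, q.2)))
  rw [← intervalIntegral.integral_sub ((hf.continuous_chargeDensity ht).intervalIntegrable _ _)
    ((hf.continuous_chargeDensity hr).intervalIntegrable _ _),
    ← intervalIntegral.integral_sub (hf.intervalIntegrable_momentum b hr ht)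
      (hf.intervalIntegrable_momentum a hr ht)]
  simp_rw [hf.chargeDensity_time_sub hr ht]
  rw [integral_swap_of_continuous
    (intervalIntegral.continuous_parametric_intervalIntegral_of_continuous' hc (-P) P)]
  exact intervalIntegral.integral_congr fun s hs =>
    (hf.momentum_sub (uIcc_subset_Icc hr ht hs) a b).symm

lemma tendsto_integral_momentum (hf : IsBoundedSolution T B P F f₀ f) {r t : ℝ}
    (hr : r ∈ Icc 0 T) (ht : t ∈ Icc 0 T) (x : ℝ) :
    Tendsto (fun L => ∫ s in r..t, (momentum f s x - (momentum f s L + momentum f s (-L)) / 2))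
      atTop (𝓝 (electricField F f t x - electricField F f r x)) := by
  have hlim : ∀ s ∈ Icc 0 T, Tendsto (fun L => (1 / 2) * ((∫ y in -L..x, chargeDensity F f s y)
      - ∫ y in x..L, chargeDensity F f s y)) atTop (𝓝 (electricField F f s x)) := fun s hs =>
    ((intervalIntegral_tendsto_integral_Iic x (hf.integrable_density s hs).integrableOn
      tendsto_neg_atTop_atBot).sub (intervalIntegral_tendsto_integral_Ioi x
        (hf.integrable_density s hs).integrableOn tendsto_id)).const_mul _
  refine ((hlim t ht).sub (hlim r hr)).congr fun L => ?_
  have hi := fun y => hf.intervalIntegrable_momentum y hr ht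
  rw [intervalIntegral.integral_sub (hi x) (((hi L).add (hi (-L))).div_const 2),
    intervalIntegral.integral_div, intervalIntegral.integral_add (hi L) (hi (-L))]
  linarith [hf.charge_balance hr ht (-L) x, hf.charge_balance hr ht x L]

lemma abs_electricField_time_sub_le (hf : IsBoundedSolution T B P F f₀ f) {r t : ℝ}
    (hr : r ∈ Icc 0 T) (ht : t ∈ Icc 0 T) (x : ℝ) :
    |electricField F f t x - electricField F f r x| ≤ 4 * P ^ 2 * B * |t - r| := by
  refine le_of_tendsto (hf.tendsto_integral_momentum hr ht x).abs
    (Eventually.of_forall fun L => ?_)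
  rw [← Real.norm_eq_abs]
  refine intervalIntegral.norm_integral_le_of_norm_le_const fun s hs => ?_
  have hbound := hf.abs_momentum_le (uIcc_subset_Icc hr ht (uIoc_subset_uIcc hs))
  have hx := abs_le.1 (hbound x)
  have hL := abs_le.1 (hbound L)
  have hL' := abs_le.1 (hbound (-L))
  exact abs_le.2 ⟨by linarith, by linarith⟩

lemma lipschitzWith_electricField (hf : IsBoundedSolution T B P F f₀ f) {t : ℝ}
    (ht : t ∈ Icc 0 T) : LipschitzWith (Real.toNNReal (4 * B * P)) (electricField F f t) := by
  have hB := hf.bound_nonneg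
  have hP := hf.velocity_pos
  refine LipschitzWith.of_dist_le_mul fun x y => ?_
  rw [Real.coe_toNNReal _ (by positivity), Real.dist_eq, Real.dist_eq,
    electricField_sub (hf.integrable_density t ht), ← Real.norm_eq_abs]
  exact intervalIntegral.norm_integral_le_of_norm_le_const fun z _ => hf.abs_chargeDensity_le ht z

lemma continuousOn_electricField (hf : IsBoundedSolution T B P F f₀ f) :
    ContinuousOn (fun p : ℝ × ℝ => electricField F f p.1 p.2) (Icc 0 T ×ˢ univ) := by
  have hB := hf.bound_nonneg
  refine continuousOn_prod_of_continuousOn_lipschitzOnWith' _ (Real.toNNReal (4 * B * P))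
    (fun t ht => (hf.lipschitzWith_electricField ht).lipschitzOnWith) fun x _ => ?_
  refine LipschitzOnWith.continuousOn (K := Real.toNNReal (4 * P ^ 2 * B))
    (LipschitzOnWith.of_dist_le_mul fun t ht r hr => ?_)
  rw [Real.coe_toNNReal _ (by positivity), Real.dist_eq, Real.dist_eq]
  exact hf.abs_electricField_time_sub_le hr ht x

lemma continuousOn_fieldSupNorm (hf : IsBoundedSolution T B P F f₀ f) :
    ContinuousOn (fieldSupNorm F f) (Icc 0 T) := by
  refine LipschitzOnWith.continuousOn (K := Real.toNNReal (4 * P ^ 2 * B))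
    (LipschitzOnWith.of_le_add_mul' _ fun t ht r hr => ciSup_le fun x => ?_)
  rw [Real.dist_eq]
  linarith [abs_sub_abs_le_abs_sub (electricField F f t x) (electricField F f r x),
    hf.abs_electricField_time_sub_le hr ht x, abs_electricField_le (hf.integrable_density r hr) x]

lemma intervalIntegrable_fieldSupNorm (hf : IsBoundedSolution T B P F f₀ f) {t : ℝ}
    (ht : t ∈ Icc 0 T) : IntervalIntegrable (fieldSupNorm F f) volume 0 t :=
  (hf.continuousOn_fieldSupNorm.mono
    (uIcc_subset_Icc ⟨le_rfl, hf.time_pos.le⟩ ht)).intervalIntegrable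

lemma exists_forall_abs_electricField_le (hf : IsBoundedSolution T B P F f₀ f) :
    ∃ C, ∀ s ∈ Icc 0 T, ∀ x, |electricField F f s x| ≤ C := by
  obtain ⟨C, hC⟩ := isCompact_Icc.exists_bound_of_continuousOn hf.continuousOn_fieldSupNorm
  exact ⟨C, fun s hs x => (abs_electricField_le (hf.integrable_density s hs) x).trans
    ((le_abs_self _).trans (hC s hs))⟩

lemma exists_characteristic (hf : IsBoundedSolution T B P F f₀ f) {t : ℝ} (ht : t ∈ Icc 0 T)
    (x v : ℝ) :
    ∃ X V : ℝ → ℝ, X t = x ∧ V t = v ∧ IsTrajectory t (fun s => electricField F f s (X s)) X V ∧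
      f t x v = f₀ (X 0) (V 0) := by
  obtain ⟨C, hC⟩ := hf.exists_forall_abs_electricField_le
  have hsub : Icc 0 t ⊆ Icc 0 T := Icc_subset_Icc_right ht.2
  obtain ⟨X, V, rfl, rfl, h⟩ := exists_isTrajectory ht.1
    (hf.continuousOn_electricField.mono (prod_mono_left hsub))
    (fun s hs => hf.lipschitzWith_electricField (hsub hs)) (fun s hs => hC s (hsub hs)) x v
  have hconst := eq_of_hasDerivWithinAt_zero (φ := fun r => f r (X r) (V r))
    (fun s hs => by simpa using hf.hasDerivWithinAt_trajectory hf.time_pos ht.2 h hs)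
    ⟨le_rfl, ht.1⟩ ⟨ht.1, le_rfl⟩
  exact ⟨X, V, rfl, rfl, h, hconst.trans (hf.initial _ _)⟩

end IsBoundedSolution

lemma tendsto_electricField {F : ℝ → ℝ} {f : ℝ → ℝ → ℝ → ℝ} {t σ : ℝ} (hσ : σ = 1 ∨ σ = -1)
    (h : Integrable fun y => chargeDensity F f t y) :
    Tendsto (fun y => electricField F f t (σ * y)) atTop (𝓝 (σ * halfCharge F f t)) := by
  have htotal : ∫ y, chargeDensity F f t y = 2 * halfCharge F f t := by unfold halfCharge; ring
  rcases hσ with rfl | rfl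
  · have hlim := ((aecover_Iic (μ := volume) (tendsto_id (α := ℝ) (x := atTop))
      ).integral_tendsto_of_countably_generated h).sub_const (halfCharge F f t)
    rw [htotal, two_mul, add_sub_cancel_right] at hlim
    simpa only [one_mul, electricField_eq_integral_Iic_sub h, id] using hlim
  · have hlim := ((aecover_Ioi (μ := volume) (tendsto_neg_atTop_atBot (G := ℝ))
      ).integral_tendsto_of_countably_generated h).const_sub (halfCharge F f t)
    rw [htotal, two_mul, sub_add_cancel_left, ← neg_one_mul] at hlim
    simpa only [neg_one_mul, electricField_eq_sub_integral_Ioi h] using hlim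

lemma tendsto_mul_atTop_of_abs_sub_le {σ D : ℝ} (hσ : σ = 1 ∨ σ = -1) {X : ℝ → ℝ}
    (h : ∀ y, |X y - σ * y| ≤ D) : Tendsto (fun y => σ * X y) atTop atTop := by
  refine tendsto_atTop_mono (fun y => ?_) (tendsto_atTop_add_const_right _ (-D) tendsto_id)
  have hy := abs_le.1 (h y)
  rcases hσ with rfl | rfl <;> simp only [id] <;> linarith

lemma integral_mul_translate {F : ℝ → ℝ} (hF : Integrable F) (hF' : Integrable fun v => v * F v)
    (c : ℝ) : ∫ v, v * F (v + c) = (∫ v, v * F v) - c * ∫ v, F v := by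
  have h := integral_add_right_eq_self (μ := volume) (fun w => (w - c) * F w) c
  simp only [add_sub_cancel_right] at h
  simp only [h, sub_mul]
  rw [integral_sub hF' (hF.const_mul c), integral_const_mul]

/-- The velocity lost up to time `t` by a particle at `+∞`, and gained by one at `-∞`: the field
there is `halfCharge` and `-halfCharge`. -/
noncomputable def farImpulse (F : ℝ → ℝ) (f : ℝ → ℝ → ℝ → ℝ) (t : ℝ) : ℝ :=
  ∫ s in 0..t, halfCharge F f s

namespace IsBoundedSolution

variable {T R B P σ t : ℝ} {F : ℝ → ℝ} {f₀ : ℝ → ℝ → ℝ} {f : ℝ → ℝ → ℝ → ℝ}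

lemma hasCompactSupport_background (hf : IsBoundedSolution T B P F f₀ f) : HasCompactSupport F :=
  HasCompactSupport.intro (isCompact_Icc (a := -P) (b := P)) fun v hv =>
    hf.background_eq_zero v (not_lt.1 fun h => hv (abs_le.1 h.le))

lemma continuousOn_halfCharge (hf : IsBoundedSolution T B P F f₀ f) :
    ContinuousOn (halfCharge F f) (Icc 0 T) := by
  have hB := hf.bound_nonneg
  refine LipschitzOnWith.continuousOn (K := Real.toNNReal (4 * P ^ 2 * B))
    (LipschitzOnWith.of_dist_le_mul fun t ht r hr => ?_)
  have hlim := (tendsto_electricField (.inl rfl) (hf.integrable_density t ht)).sub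
    (tendsto_electricField (.inl rfl) (hf.integrable_density r hr))
  simp only [one_mul] at hlim
  rw [Real.coe_toNNReal _ (by positivity), Real.dist_eq, Real.dist_eq]
  exact le_of_tendsto hlim.abs
    (Eventually.of_forall fun y => hf.abs_electricField_time_sub_le hr ht y)

lemma tendsto_position (hf : IsBoundedSolution T B P F f₀ f) (hσ : σ = 1 ∨ σ = -1)
    (ht : t ∈ Icc 0 T) {v : ℝ} {X V : ℝ → ℝ → ℝ} (hX : ∀ y, X y t = σ * y) (hV : ∀ y, V y t = v)
    (h : ∀ y, IsTrajectory t (fun s => electricField F f s (X y s)) (X y) (V y)) {s : ℝ}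
    (hs : s ∈ Icc 0 t) : Tendsto (fun y => σ * X y s) atTop atTop := by
  refine tendsto_mul_atTop_of_abs_sub_le
    (D := (t - s) * |v| + ∫ τ in s..t, ∫ r in τ..t, fieldSupNorm F f r) hσ fun y => ?_
  simpa only [hX, hV] using (h y).abs_position_sub_le (hf.intervalIntegrable_fieldSupNorm ht)
    (fun r hr => abs_electricField_le (hf.integrable_density r ⟨hr.1, hr.2.trans ht.2⟩) _) hs

lemma tendsto_initial_velocity (hf : IsBoundedSolution T B P F f₀ f) (hσ : σ = 1 ∨ σ = -1)
    (ht : t ∈ Icc 0 T) {v : ℝ} {X V : ℝ → ℝ → ℝ} (hX : ∀ y, X y t = σ * y) (hV : ∀ y, V y t = v)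
    (h : ∀ y, IsTrajectory t (fun s => electricField F f s (X y s)) (X y) (V y)) :
    Tendsto (fun y => V y 0) atTop (𝓝 (v + σ * farImpulse F f t)) := by
  have hmem : ∀ s ∈ uIoc 0 t, s ∈ Icc 0 t := fun s hs => by
    rw [uIoc_of_le ht.1] at hs; exact Ioc_subset_Icc_self hs
  have hint : ∀ s ∈ Icc 0 t, Integrable fun y => chargeDensity F f s y := fun s hs =>
    hf.integrable_density s ⟨hs.1, hs.2.trans ht.2⟩
  have hE : ∀ s ∈ Icc 0 t, Tendsto (fun y => electricField F f s (X y s)) atTop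
      (𝓝 (σ * halfCharge F f s)) := fun s hs => by
    have hσσ : σ * σ = 1 := by rcases hσ with rfl | rfl <;> norm_num
    simpa only [Function.comp_def, ← mul_assoc, hσσ, one_mul] using
      (tendsto_electricField hσ (hint s hs)).comp (hf.tendsto_position hσ ht hX hV h hs)
  have hlim : Tendsto (fun y => ∫ s in 0..t, electricField F f s (X y s)) atTop
      (𝓝 (∫ s in 0..t, σ * halfCharge F f s)) :=
    intervalIntegral.tendsto_integral_filter_of_dominated_convergence (fieldSupNorm F f)
      (Eventually.of_forall fun y =>
        ((h y).continuousOn.mono hmem).aestronglyMeasurable measurableSet_uIoc)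
      (Eventually.of_forall fun y => Eventually.of_forall fun s hs =>
        abs_electricField_le (hint s (hmem s hs)) _) (hf.intervalIntegrable_fieldSupNorm ht)
      (Eventually.of_forall fun s hs => hE s (hmem s hs))
  rw [intervalIntegral.integral_const_mul] at hlim
  exact (hlim.const_add v).congr fun y => by rw [(h y).velocity_eq ⟨le_rfl, ht.1⟩, hV]

lemma tendsto_far (hf : IsBoundedSolution T B P F f₀ f) (hfar : ∀ x v, R < |x| → f₀ x v = F v)
    (hσ : σ = 1 ∨ σ = -1) (ht : t ∈ Icc 0 T) (v : ℝ) :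
    Tendsto (fun y => f t (σ * y) v) atTop (𝓝 (F (v + σ * farImpulse F f t))) := by
  choose X V hX hV h hfX using fun y => hf.exists_characteristic ht (σ * y) v
  refine ((hf.background_contDiff.continuous.tendsto _).comp
    (hf.tendsto_initial_velocity hσ ht hX hV h)).congr' ?_
  filter_upwards [(hf.tendsto_position hσ ht hX hV h ⟨le_rfl, ht.1⟩).eventually_gt_atTop R]
    with y hy
  rw [Function.comp_apply, hfX, hfar]
  calc R < σ * X y 0 := hy
    _ ≤ |σ * X y 0| := le_abs_self _
    _ = |X y 0| := by rw [abs_mul]; rcases hσ with rfl | rfl <;> simp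

lemma translate_eq_zero (hf : IsBoundedSolution T B P F f₀ f)
    (hfar : ∀ x v, R < |x| → f₀ x v = F v) (hσ : σ = 1 ∨ σ = -1) (ht : t ∈ Icc 0 T) {v : ℝ}
    (hv : P ≤ |v|) : F (v + σ * farImpulse F f t) = 0 := by
  have h := hf.tendsto_far hfar hσ ht v
  simp only [hf.eq_zero t ht _ v hv] at h
  exact tendsto_nhds_unique h tendsto_const_nhds

lemma integral_mul_far (hf : IsBoundedSolution T B P F f₀ f)
    (hfar : ∀ x v, R < |x| → f₀ x v = F v) (hσ : σ = 1 ∨ σ = -1) (ht : t ∈ Icc 0 T) :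
    ∫ v in -P..P, v * F (v + σ * farImpulse F f t)
      = (∫ v, v * F v) - σ * farImpulse F f t * ∫ v, F v := by
  have hF := hf.background_contDiff.continuous
  rw [← integral_mul_translate (hF.integrable_of_hasCompactSupport hf.hasCompactSupport_background)
    ((continuous_id.mul hF).integrable_of_hasCompactSupport
      hf.hasCompactSupport_background.mul_left)]
  refine (integral_eq_of_eq_zero fun v hv => ?_).symm
  rw [hf.translate_eq_zero hfar hσ ht hv, mul_zero]

lemma tendsto_momentum (hf : IsBoundedSolution T B P F f₀ f)
    (hfar : ∀ x v, R < |x| → f₀ x v = F v) (hσ : σ = 1 ∨ σ = -1) (ht : t ∈ Icc 0 T) :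
    Tendsto (fun y => momentum f t (σ * y)) atTop
      (𝓝 ((∫ v, v * F v) - σ * farImpulse F f t * ∫ v, F v)) := by
  rw [← hf.integral_mul_far hfar hσ ht]
  simp only [hf.momentum_eq ht]
  refine intervalIntegral.tendsto_integral_filter_of_dominated_convergence (fun v => |v| * B)
    (Eventually.of_forall fun y => ?_)
    (Eventually.of_forall fun y => Eventually.of_forall fun v _ => ?_)
    (Continuous.intervalIntegrable (by fun_prop) _ _)
    (Eventually.of_forall fun v _ => (hf.tendsto_far hfar hσ ht v).const_mul v)
  · exact (continuous_id.mul (hf.continuous_slice ht _)).aestronglyMeasurable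
  · rw [norm_mul]
    exact mul_le_mul_of_nonneg_left (hf.abs_le t ht _ v) (abs_nonneg v)

lemma electricField_time_sub (hf : IsBoundedSolution T B P F f₀ f)
    (hfar : ∀ x v, R < |x| → f₀ x v = F v) {r : ℝ} (hr : r ∈ Icc 0 T) (ht : t ∈ Icc 0 T) (x : ℝ) :
    electricField F f t x - electricField F f r x
      = ∫ s in r..t, (momentum f s x - ∫ v, v * F v) := by
  have hmem : ∀ s ∈ uIoc r t, s ∈ Icc 0 T := fun s hs =>
    uIcc_subset_Icc hr ht (uIoc_subset_uIcc hs)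
  have hi := fun y => hf.intervalIntegrable_momentum y hr ht
  refine tendsto_nhds_unique (hf.tendsto_integral_momentum hr ht x)
    (intervalIntegral.tendsto_integral_filter_of_dominated_convergence (fun _ => 4 * P ^ 2 * B)
    (Eventually.of_forall fun L =>
      ((hi x).sub (((hi L).add (hi (-L))).div_const 2)).def'.aestronglyMeasurable)
    (Eventually.of_forall fun L => Eventually.of_forall fun s hs => ?_) intervalIntegrable_const
    (Eventually.of_forall fun s hs => ?_))
  · have hx := abs_le.1 (hf.abs_momentum_le (hmem s hs) x)
    have hL := abs_le.1 (hf.abs_momentum_le (hmem s hs) L)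
    have hL' := abs_le.1 (hf.abs_momentum_le (hmem s hs) (-L))
    exact abs_le.2 ⟨by linarith, by linarith⟩
  · have hlim := (((hf.tendsto_momentum hfar (.inl rfl) (hmem s hs)).add
      (hf.tendsto_momentum hfar (.inr rfl) (hmem s hs))).div_const 2).const_sub (momentum f s x)
    simp only [one_mul, neg_one_mul] at hlim
    convert hlim using 2
    ring

lemma halfCharge_time_sub (hf : IsBoundedSolution T B P F f₀ f)
    (hfar : ∀ x v, R < |x| → f₀ x v = F v) {r : ℝ} (hr : r ∈ Icc 0 T) (ht : t ∈ Icc 0 T) :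
    halfCharge F f t - halfCharge F f r = ∫ s in r..t, -(∫ v, F v) * farImpulse F f s := by
  have hmem : ∀ s ∈ uIoc r t, s ∈ Icc 0 T := fun s hs =>
    uIcc_subset_Icc hr ht (uIoc_subset_uIcc hs)
  have hE := (tendsto_electricField (.inl rfl) (hf.integrable_density t ht)).sub
    (tendsto_electricField (.inl rfl) (hf.integrable_density r hr))
  simp only [one_mul, hf.electricField_time_sub hfar hr ht] at hE
  refine tendsto_nhds_unique hE
    (intervalIntegral.tendsto_integral_filter_of_dominated_convergence
    (fun _ => 2 * P ^ 2 * B + |∫ v, v * F v|)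
    (Eventually.of_forall fun y =>
      ((hf.intervalIntegrable_momentum y hr ht).sub intervalIntegrable_const
        ).def'.aestronglyMeasurable)
    (Eventually.of_forall fun y => Eventually.of_forall fun s hs => (abs_sub _ _).trans
      (add_le_add_left (hf.abs_momentum_le (hmem s hs) y) _)) intervalIntegrable_const
    (Eventually.of_forall fun s hs => ?_))
  have hlim := (hf.tendsto_momentum hfar (.inl rfl) (hmem s hs)).sub_const (∫ v, v * F v)
  simp only [one_mul] at hlim
  convert hlim using 2
  ring

end IsBoundedSolution

namespace IsC1Solution

variable {T R : ℝ} {F : ℝ → ℝ} {f₀ : ℝ → ℝ → ℝ} {f : ℝ → ℝ → ℝ → ℝ}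

lemma chargeDensity_zero (hf : IsC1Solution T F f₀ f) (hfar : ∀ x v, R < |x| → f₀ x v = F v)
    {x : ℝ} (hx : R < |x|) : chargeDensity F f 0 x = 0 := by
  simp only [chargeDensity, hf.initial, hfar x _ hx, sub_self, integral_zero]

lemma halfCharge_zero (hf : IsC1Solution T F f₀ f) (hR : 0 ≤ R)
    (hfar : ∀ x v, R < |x| → f₀ x v = F v) : halfCharge F f 0 = initialFieldStrength R F f₀ := by
  unfold halfCharge initialFieldStrength
  rw [intervalIntegral.integral_of_le (by linarith), ← integral_Icc_eq_integral_Ioc,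
    ← setIntegral_eq_integral_of_forall_compl_eq_zero (s := Icc (-R) R) fun y hy =>
      hf.chargeDensity_zero hfar (not_le.1 fun h => hy (abs_le.1 h))]
  simp only [chargeDensity, hf.initial]

lemma electricField_zero (hf : IsC1Solution T F f₀ f) (hT : 0 ≤ T)
    (hfar : ∀ x v, R < |x| → f₀ x v = F v) {x : ℝ} (hx : R < |x|) :
    electricField F f 0 x = sgn x * halfCharge F f 0 := by
  have hi := hf.integrable_density 0 ⟨le_rfl, hT⟩
  rcases le_or_gt 0 x with h | h
  · rw [abs_of_nonneg h] at hx
    rw [electricField_eq_sub_integral_Ioi hi, sgn, if_pos h,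
      setIntegral_eq_zero_of_forall_eq_zero (t := Ioi x) fun y hy =>
        hf.chargeDensity_zero hfar ((hx.trans hy).trans_le (le_abs_self y))]
    ring
  · rw [abs_of_neg h] at hx
    rw [electricField_eq_integral_Iic_sub hi, sgn, if_neg h.not_ge,
      setIntegral_eq_zero_of_forall_eq_zero (t := Iic x) fun y hy =>
        hf.chargeDensity_zero hfar ((hx.trans_le (neg_le_neg hy)).trans_le (neg_le_abs y))]
    ring

end IsC1Solution

section Oscillation

variable {a b : ℝ}

lemma hasDerivWithinAt_integral_Icc {u : ℝ → ℝ} (hu : ContinuousOn u (Icc a b)) {t : ℝ}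
    (ht : t ∈ Icc a b) : HasDerivWithinAt (fun r => ∫ s in a..r, u s) (u t) (Icc a b) t := by
  have : Fact (t ∈ Icc a b) := ⟨ht⟩
  exact intervalIntegral.integral_hasDerivWithinAt_right (hu.mono
    (uIcc_subset_Icc ⟨le_rfl, ht.1.trans ht.2⟩ ht)).intervalIntegrable
    (hu.stronglyMeasurableAtFilter_nhdsWithin measurableSet_Icc t) (hu t ht)

lemma harmonic_oscillator {A θ : ℝ → ℝ} {T ω : ℝ}
    (hθ : ∀ s ∈ Icc 0 T, HasDerivWithinAt θ (A s) (Icc 0 T) s)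
    (hA : ∀ s ∈ Icc 0 T, HasDerivWithinAt A (-ω ^ 2 * θ s) (Icc 0 T) s) (h₀ : θ 0 = 0) {t : ℝ}
    (ht : t ∈ Icc 0 T) :
    A t = A 0 * Real.cos (ω * t) ∧ ω * θ t = A 0 * Real.sin (ω * t) := by
  have h0 : (0 : ℝ) ∈ Icc 0 T := ⟨le_rfl, ht.1.trans ht.2⟩
  have hω (s : ℝ) : HasDerivAt (fun r => ω * r) ω s := by
    simpa only [mul_one] using (hasDerivAt_id' s).const_mul ω
  have hcos (s : ℝ) := (hω s).cos.hasDerivWithinAt (s := Icc 0 T)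
  have hsin (s : ℝ) := (hω s).sin.hasDerivWithinAt (s := Icc 0 T)
  have hp := eq_of_hasDerivWithinAt_zero
    (φ := fun s => A s * Real.cos (ω * s) + ω * θ s * Real.sin (ω * s)) (fun s hs => by
      convert! ((hA s hs).mul (hcos s)).add (((hθ s hs).const_mul ω).mul (hsin s)) using 1
      ring) h0 ht
  have hq := eq_of_hasDerivWithinAt_zero
    (φ := fun s => A s * Real.sin (ω * s) - ω * θ s * Real.cos (ω * s)) (fun s hs => by
      convert! ((hA s hs).mul (hsin s)).sub (((hθ s hs).const_mul ω).mul (hcos s)) using 1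
      ring) h0 ht
  simp only [mul_zero, Real.cos_zero, Real.sin_zero, h₀, mul_one, add_zero, sub_zero] at hp hq
  have hcs := Real.sin_sq_add_cos_sq (ω * t)
  constructor
  · linear_combination Real.cos (ω * t) * hp + Real.sin (ω * t) * hq - A t * hcs
  · linear_combination Real.sin (ω * t) * hp - Real.cos (ω * t) * hq - ω * θ t * hcs

end Oscillation

namespace IsBoundedSolution

variable {T R B P t : ℝ} {F : ℝ → ℝ} {f₀ : ℝ → ℝ → ℝ} {f : ℝ → ℝ → ℝ → ℝ}

lemma hasDerivWithinAt_farImpulse (hf : IsBoundedSolution T B P F f₀ f) (ht : t ∈ Icc 0 T) :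
    HasDerivWithinAt (farImpulse F f) (halfCharge F f t) (Icc 0 T) t :=
  hasDerivWithinAt_integral_Icc hf.continuousOn_halfCharge ht

lemma continuousOn_farImpulse (hf : IsBoundedSolution T B P F f₀ f) :
    ContinuousOn (farImpulse F f) (Icc 0 T) := fun _ hs =>
  (hf.hasDerivWithinAt_farImpulse hs).continuousWithinAt

lemma hasDerivWithinAt_halfCharge (hf : IsBoundedSolution T B P F f₀ f)
    (hfar : ∀ x v, R < |x| → f₀ x v = F v) (ht : t ∈ Icc 0 T) :
    HasDerivWithinAt (halfCharge F f) (-(∫ v, F v) * farImpulse F f t) (Icc 0 T) t := by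
  have hcont : ContinuousOn (fun s => -(∫ v, F v) * farImpulse F f s) (Icc 0 T) :=
    continuousOn_const.mul hf.continuousOn_farImpulse
  refine ((hasDerivWithinAt_integral_Icc hcont ht).const_add (halfCharge F f 0)).congr_of_mem
    (fun r hr => ?_) ht
  rw [← hf.halfCharge_time_sub hfar ⟨le_rfl, hf.time_pos.le⟩ hr]
  ring

lemma halfCharge_eq_cos_and_farImpulse_eq_sin (hf : IsBoundedSolution T B P F f₀ f) (hR : 0 ≤ R)
    (hfar : ∀ x v, R < |x| → f₀ x v = F v) (hF₀ : ∀ v, 0 ≤ F v) (ht : t ∈ Icc 0 T) :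
    halfCharge F f t = initialFieldStrength R F f₀ * Real.cos (frequency F * t) ∧
      frequency F * farImpulse F f t =
        initialFieldStrength R F f₀ * Real.sin (frequency F * t) := by
  rw [← hf.halfCharge_zero hR hfar]
  refine harmonic_oscillator (fun s hs => hf.hasDerivWithinAt_farImpulse hs) (fun s hs => ?_)
    intervalIntegral.integral_same ht
  rw [frequency, Real.sq_sqrt (integral_nonneg hF₀)]
  exact hf.hasDerivWithinAt_halfCharge hfar hs

end IsBoundedSolution

section Exterior

lemma sgn_eq_or (x : ℝ) : sgn x = 1 ∨ sgn x = -1 := by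
  unfold sgn; split_ifs <;> simp

lemma sgn_eq_of_abs_sub_lt {x y : ℝ} (h : |y - x| < |x|) : sgn y = sgn x := by
  unfold sgn
  rw [abs_lt] at h
  by_cases hx : 0 ≤ x
  · rw [abs_of_nonneg hx] at h
    rw [if_pos hx, if_pos (by linarith)]
  · rw [abs_of_neg (not_le.1 hx)] at h
    rw [if_neg hx, if_neg (by linarith)]

lemma velocityRadius_nonneg (F : ℝ → ℝ) (f : ℝ → ℝ → ℝ → ℝ) (t : ℝ) :
    0 ≤ velocityRadius F f t := by
  refine Real.sSup_nonneg ?_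
  rintro _ ⟨v, -, -, -, -, rfl⟩
  exact abs_nonneg v

lemma spatialRadius_zero (R : ℝ) (F : ℝ → ℝ) (f : ℝ → ℝ → ℝ → ℝ) :
    spatialRadius R F f 0 = R := by
  simp [spatialRadius]

lemma eq_zero_of_forall_abs_le_integral {ι : Type*} {T c M : ℝ} (hc : 0 ≤ c) {S : ℝ → Set ι}
    {d : ℝ → ι → ℝ} (hM : ∀ t ∈ Icc 0 T, ∀ x ∈ S t, |d t x| ≤ M)
    (hd : ∀ φ : ℝ → ℝ, Continuous φ → Monotone φ → (∀ t ∈ Icc 0 T, ∀ x ∈ S t, |d t x| ≤ φ t) →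
      ∀ t ∈ Icc 0 T, ∀ x ∈ S t, |d t x| ≤ c * ∫ s in 0..t, φ s)
    {t : ℝ} (ht : t ∈ Icc 0 T) {x : ι} (hx : x ∈ S t) : d t x = 0 := by
  have hM₀ : 0 ≤ M := (abs_nonneg _).trans (hM t ht x hx)
  have hexp (s : ℝ) : 2 * c * ∫ r in 0..s, Real.exp (2 * c * r) = Real.exp (2 * c * s) - 1 := by
    rw [intervalIntegral.mul_integral_comp_mul_left, integral_exp, mul_zero, Real.exp_zero]
  -- The weight `exp (2ct)` makes each application of `hd` halve the bound.
  have hhalve (n : ℕ) : ∀ s ∈ Icc 0 T, ∀ y ∈ S s,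
      |d s y| ≤ M * (1 / 2) ^ n * Real.exp (2 * c * s) := by
    induction n with
    | zero =>
      intro s hs y hy
      have hs₀ : 0 ≤ 2 * c * s := mul_nonneg (by linarith) hs.1
      rw [pow_zero, mul_one]
      exact (hM s hs y hy).trans (le_mul_of_one_le_right hM₀ (Real.one_le_exp hs₀))
    | succ n ih =>
      intro s hs y hy
      refine (hd _ (by fun_prop) (fun r r' hr => by gcongr) ih s hs y hy).trans ?_
      rw [intervalIntegral.integral_const_mul]
      calc _ = M * (1 / 2) ^ (n + 1) * (2 * c * ∫ r in 0..s, Real.exp (2 * c * r)) := by ring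
        _ ≤ M * (1 / 2) ^ (n + 1) * Real.exp (2 * c * s) := by
          rw [hexp]
          exact mul_le_mul_of_nonneg_left (by linarith) (by positivity)
  have hlim : Tendsto (fun n : ℕ => M * (1 / 2) ^ n * Real.exp (2 * c * t)) atTop (𝓝 0) := by
    simpa using ((tendsto_pow_atTop_nhds_zero_of_lt_one (r := (1 / 2 : ℝ)) (by norm_num)
      (by norm_num)).const_mul M).mul_const (Real.exp (2 * c * t))
  exact abs_nonpos_iff.1 (ge_of_tendsto' hlim fun n => hhalve n t ht x hx)

lemma eq_zero_of_frequency_eq_zero {F : ℝ → ℝ} (hF : Continuous F) (hF₀ : ∀ v, 0 ≤ F v)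
    (hsupp : HasCompactSupport F) (h : frequency F = 0) : F = 0 :=
  (hF.ae_eq_iff_eq volume continuous_const).1
    ((integral_eq_zero_iff_of_nonneg hF₀ (hF.integrable_of_hasCompactSupport hsupp)).1
      ((Real.sqrt_eq_zero (integral_nonneg hF₀)).1 h))

end Exterior

namespace IsBoundedSolution

variable {T R B P s t x : ℝ} {F : ℝ → ℝ} {f₀ : ℝ → ℝ → ℝ} {f : ℝ → ℝ → ℝ → ℝ}

lemma bddAbove_velocity (hf : IsBoundedSolution T B P F f₀ f) (ht : t ∈ Icc 0 T) :
    BddAbove {r : ℝ | ∃ v x : ℝ, ∃ τ ∈ Icc 0 t, F v - f τ x v ≠ 0 ∧ r = |v|} := by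
  refine ⟨P, ?_⟩
  rintro _ ⟨v, x, τ, hτ, hne, rfl⟩
  by_contra! h
  exact hne (by rw [hf.background_eq_zero v h.le,
    hf.eq_zero τ ⟨hτ.1, hτ.2.trans ht.2⟩ x v h.le, sub_zero])

lemma velocityRadius_mono (hf : IsBoundedSolution T B P F f₀ f) (ht : t ∈ Icc 0 T)
    (hst : s ≤ t) : velocityRadius F f s ≤ velocityRadius F f t := by
  refine Real.sSup_le ?_ (velocityRadius_nonneg F f t)
  rintro _ ⟨v, x, τ, hτ, hne, rfl⟩
  exact le_csSup (hf.bddAbove_velocity ht) ⟨v, x, τ, ⟨hτ.1, hτ.2.trans hst⟩, hne, rfl⟩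

lemma eq_background (hf : IsBoundedSolution T B P F f₀ f) (ht : t ∈ Icc 0 T) {v : ℝ}
    (hv : velocityRadius F f t < |v|) (x : ℝ) : f t x v = F v := by
  by_contra h
  exact hv.not_ge (le_csSup (hf.bddAbove_velocity ht)
    ⟨v, x, t, ⟨ht.1, le_rfl⟩, sub_ne_zero.2 (Ne.symm h), rfl⟩)

lemma spatialRadius_add_le (hf : IsBoundedSolution T B P F f₀ f) (ht : t ∈ Icc 0 T)
    (hs : s ∈ Icc 0 t) :
    spatialRadius R F f s + (t - s) * velocityRadius F f t
      + ∫ τ in s..t, ∫ r in τ..t, fieldSupNorm F f r ≤ spatialRadius R F f t := by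
  have het := hf.intervalIntegrable_fieldSupNorm ht
  have hes := hf.intervalIntegrable_fieldSupNorm (t := s) ⟨hs.1, hs.2.trans ht.2⟩
  have hct := IsTrajectory.continuousOn_tail_integral het ht.1
  have hcs := IsTrajectory.continuousOn_tail_integral hes hs.1
  rw [← uIcc_of_le hs.1] at hcs
  have hs' : s ∈ uIcc 0 t := by rwa [uIcc_of_le ht.1]
  rw [← uIcc_of_le ht.1] at hct
  have hi₀ : IntervalIntegrable (fun τ => ∫ r in τ..t, fieldSupNorm F f r) volume 0 s :=
    (hct.mono (uIcc_subset_uIcc left_mem_uIcc hs')).intervalIntegrable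
  have hsplit := intervalIntegral.integral_add_adjacent_intervals hi₀
    (hct.mono (uIcc_subset_uIcc hs' right_mem_uIcc)).intervalIntegrable
  have htail : ∫ τ in 0..s, ∫ r in τ..s, fieldSupNorm F f r
      ≤ ∫ τ in 0..s, ∫ r in τ..t, fieldSupNorm F f r := by
    refine intervalIntegral.integral_mono_on hs.1 hcs.intervalIntegrable hi₀ fun τ hτ => ?_
    refine intervalIntegral.integral_mono_interval le_rfl hτ.2 hs.2
      (Eventually.of_forall fun r => fieldSupNorm_nonneg F f r) (het.mono_set ?_)
    rw [uIcc_of_le (hτ.2.trans hs.2), uIcc_of_le ht.1]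
    exact Icc_subset_Icc_left hτ.1
  have hQ : s * velocityRadius F f s ≤ s * velocityRadius F f t :=
    mul_le_mul_of_nonneg_left (hf.velocityRadius_mono ht hs.2) hs.1
  unfold spatialRadius
  linarith

lemma spatialRadius_mono (hf : IsBoundedSolution T B P F f₀ f) (ht : t ∈ Icc 0 T)
    (hs : s ∈ Icc 0 t) : spatialRadius R F f s ≤ spatialRadius R F f t := by
  have hadd := hf.spatialRadius_add_le (R := R) ht hs
  have hQ : 0 ≤ (t - s) * velocityRadius F f t :=
    mul_nonneg (sub_nonneg.2 hs.2) (velocityRadius_nonneg F f t)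
  have hE : 0 ≤ ∫ τ in s..t, ∫ r in τ..t, fieldSupNorm F f r :=
    intervalIntegral.integral_nonneg hs.2 fun τ hτ =>
      intervalIntegral.integral_nonneg hτ.2 fun r _ => fieldSupNorm_nonneg F f r
  linarith

lemma lt_abs_of_spatialRadius_lt (hf : IsBoundedSolution T B P F f₀ f) (ht : t ∈ Icc 0 T)
    (hx : spatialRadius R F f t < |x|) : R < |x| := by
  have h := hf.spatialRadius_mono (R := R) ht (s := 0) ⟨le_rfl, ht.1⟩
  rw [spatialRadius_zero] at h
  exact h.trans_lt hx

lemma spatialRadius_lt_abs_position (hf : IsBoundedSolution T B P F f₀ f) (hR : 0 ≤ R)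
    (ht : t ∈ Icc 0 T) {X V : ℝ → ℝ}
    (h : IsTrajectory t (fun s => electricField F f s (X s)) X V)
    (hx : spatialRadius R F f t < |X t|) (hv : |V t| ≤ velocityRadius F f t) (hs : s ∈ Icc 0 t) :
    spatialRadius R F f s < |X s| ∧ sgn (X s) = sgn (X t) := by
  have hdist := h.abs_position_sub_le (hf.intervalIntegrable_fieldSupNorm ht)
    (fun r hr => abs_electricField_le (hf.integrable_density r ⟨hr.1, hr.2.trans ht.2⟩) _) hs
  have hadd := hf.spatialRadius_add_le (R := R) ht hs
  have hvel : (t - s) * |V t| ≤ (t - s) * velocityRadius F f t :=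
    mul_le_mul_of_nonneg_left hv (sub_nonneg.2 hs.2)
  have hRs := hf.spatialRadius_mono (R := R) (s := 0) ⟨hs.1, hs.2.trans ht.2⟩ ⟨le_rfl, hs.1⟩
  rw [spatialRadius_zero] at hRs
  have htri := abs_sub_abs_le_abs_sub (X t) (X s)
  rw [abs_sub_comm] at htri
  exact ⟨by linarith, sgn_eq_of_abs_sub_lt (by linarith)⟩

lemma abs_initial_velocity_sub_le (hf : IsBoundedSolution T B P F f₀ f) (hR : 0 ≤ R)
    (ht : t ∈ Icc 0 T) {δ : ℝ}
    (hδ : ∀ s ∈ Icc 0 t, ∀ y, spatialRadius R F f s < |y| →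
      |electricField F f s y - sgn y * halfCharge F f s| ≤ δ) {X V : ℝ → ℝ}
    (h : IsTrajectory t (fun s => electricField F f s (X s)) X V)
    (hx : spatialRadius R F f t < |X t|) (hv : |V t| ≤ velocityRadius F f t) :
    |V 0 - (V t + sgn (X t) * farImpulse F f t)| ≤ δ * t := by
  have hsub : uIcc 0 t ⊆ Icc 0 T := by
    rw [uIcc_of_le ht.1]; exact Icc_subset_Icc_right ht.2
  have hA : IntervalIntegrable (halfCharge F f) volume 0 t :=
    (hf.continuousOn_halfCharge.mono hsub).intervalIntegrable
  have hE : IntervalIntegrable (fun s => electricField F f s (X s)) volume 0 t :=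
    (h.continuousOn.mono (uIcc_of_le ht.1).subset).intervalIntegrable
  rw [h.velocity_eq ⟨le_rfl, ht.1⟩, add_sub_add_left_eq_sub, farImpulse,
    ← intervalIntegral.integral_const_mul, ← intervalIntegral.integral_sub hE (hA.const_mul _),
    ← Real.norm_eq_abs]
  refine (intervalIntegral.norm_integral_le_of_norm_le_const (C := δ) fun s hs => ?_).trans_eq
    (by rw [sub_zero, abs_of_nonneg ht.1])
  rw [uIoc_of_le ht.1] at hs
  have hs := Ioc_subset_Icc_self hs
  obtain ⟨hXs, hsgn⟩ := hf.spatialRadius_lt_abs_position hR ht h hx hv hs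
  rw [← hsgn]
  exact hδ s hs _ hXs

lemma abs_sub_translate_le (hf : IsBoundedSolution T B P F f₀ f) (hR : 0 ≤ R)
    (hfar : ∀ x v, R < |x| → f₀ x v = F v) {Λ : ℝ≥0} (hΛ : LipschitzWith Λ F)
    (ht : t ∈ Icc 0 T) {δ : ℝ}
    (hδ : ∀ s ∈ Icc 0 t, ∀ y, spatialRadius R F f s < |y| →
      |electricField F f s y - sgn y * halfCharge F f s| ≤ δ)
    (hx : spatialRadius R F f t < |x|) (v : ℝ) :
    |f t x v - F (v + sgn x * farImpulse F f t)| ≤ Λ * (δ * t) := by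
  rcases lt_or_ge (velocityRadius F f t) |v| with hv | hv
  · have hlim := hf.tendsto_far hfar (sgn_eq_or x) ht v
    simp only [hf.eq_background ht hv] at hlim
    rw [hf.eq_background ht hv, ← tendsto_nhds_unique hlim tendsto_const_nhds, sub_self, abs_zero]
    exact mul_nonneg Λ.2
      (mul_nonneg ((abs_nonneg _).trans (hδ t ⟨ht.1, le_rfl⟩ x hx)) ht.1)
  obtain ⟨X, V, rfl, rfl, h, hfX⟩ := hf.exists_characteristic ht x v
  have hX₀ := (hf.spatialRadius_lt_abs_position hR ht h hx hv ⟨le_rfl, ht.1⟩).1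
  rw [spatialRadius_zero] at hX₀
  rw [hfX, hfar _ _ hX₀]
  exact (hΛ.dist_le_mul _ _).trans
    (mul_le_mul_of_nonneg_left (hf.abs_initial_velocity_sub_le hR ht hδ h hx hv) Λ.2)

lemma abs_momentum_sub_far_le (hf : IsBoundedSolution T B P F f₀ f)
    (hfar : ∀ x v, R < |x| → f₀ x v = F v) (ht : t ∈ Icc 0 T) {δ : ℝ}
    (hδ : ∀ v, |f t x v - F (v + sgn x * farImpulse F f t)| ≤ δ) :
    |momentum f t x - ((∫ v, v * F v) - sgn x * farImpulse F f t * ∫ v, F v)|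
      ≤ 2 * P ^ 2 * δ := by
  have hF := hf.background_contDiff.continuous
  have hc := hf.continuous_slice ht x
  rw [← hf.integral_mul_far hfar (sgn_eq_or x) ht, hf.momentum_eq ht,
    ← intervalIntegral.integral_sub (Continuous.intervalIntegrable (by fun_prop) _ _)
      (Continuous.intervalIntegrable (by fun_prop) _ _)]
  simp only [← mul_sub]
  exact abs_integral_mul_le hf.velocity_pos.le hδ

lemma electricField_sub_far (hf : IsBoundedSolution T B P F f₀ f)
    (hfar : ∀ x v, R < |x| → f₀ x v = F v) (ht : t ∈ Icc 0 T) (hx : R < |x|) :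
    electricField F f t x - sgn x * halfCharge F f t
      = ∫ s in 0..t,
        (momentum f s x - ((∫ v, v * F v) - sgn x * farImpulse F f s * ∫ v, F v)) := by
  have h0 : (0 : ℝ) ∈ Icc 0 T := ⟨le_rfl, hf.time_pos.le⟩
  have hsub : uIcc 0 t ⊆ Icc 0 T := uIcc_subset_Icc h0 ht
  have hi : IntervalIntegrable (fun s => -(∫ v, F v) * farImpulse F f s) volume 0 t :=
    ((continuousOn_const.mul hf.continuousOn_farImpulse).mono hsub).intervalIntegrable
  calc _ = (electricField F f t x - electricField F f 0 x)
        - sgn x * (halfCharge F f t - halfCharge F f 0) := by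
        rw [hf.electricField_zero hf.time_pos.le hfar hx]; ring
    _ = ∫ s in 0..t, ((momentum f s x - ∫ v, v * F v)
        - sgn x * (-(∫ v, F v) * farImpulse F f s)) := by
        rw [hf.electricField_time_sub hfar h0 ht, hf.halfCharge_time_sub hfar h0 ht,
          ← intervalIntegral.integral_const_mul, intervalIntegral.integral_sub
            ((hf.intervalIntegrable_momentum x h0 ht).sub intervalIntegrable_const)
            (hi.const_mul _)]
    _ = _ := by congr 1; ext s; ring

lemma exists_forall_abs_electricField_sub_far_le (hf : IsBoundedSolution T B P F f₀ f) :
    ∃ M, ∀ t ∈ Icc 0 T, ∀ x, |electricField F f t x - sgn x * halfCharge F f t| ≤ M := by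
  obtain ⟨M₁, hM₁⟩ := hf.exists_forall_abs_electricField_le
  obtain ⟨M₂, hM₂⟩ := isCompact_Icc.exists_bound_of_continuousOn hf.continuousOn_halfCharge
  refine ⟨M₁ + M₂, fun t ht x => (abs_sub _ _).trans (add_le_add (hM₁ t ht x) ?_)⟩
  rw [abs_mul]
  rcases sgn_eq_or x with h | h <;> simpa [h] using hM₂ t ht

lemma electricField_exterior (hf : IsBoundedSolution T B P F f₀ f) (hR : 0 ≤ R)
    (hfar : ∀ x v, R < |x| → f₀ x v = F v) (ht : t ∈ Icc 0 T)
    (hx : spatialRadius R F f t < |x|) :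
    electricField F f t x = sgn x * halfCharge F f t := by
  obtain ⟨Λ, hΛ⟩ := ContDiff.lipschitzWith_of_hasCompactSupport
    hf.hasCompactSupport_background hf.background_contDiff one_ne_zero
  obtain ⟨M, hM⟩ := hf.exists_forall_abs_electricField_sub_far_le
  have hT := hf.time_pos
  refine sub_eq_zero.1 (eq_zero_of_forall_abs_le_integral (c := 2 * P ^ 2 * (Λ * T)) (by positivity)
    (S := fun s => {y | spatialRadius R F f s < |y|})
    (d := fun s y => electricField F f s y - sgn y * halfCharge F f s)
    (fun s hs y _ => hM s hs y) (fun φ hφ hmono hbound s hs y hy => ?_) ht hx)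
  have hstep : ∀ r ∈ Icc 0 s,
      |momentum f r y - ((∫ v, v * F v) - sgn y * farImpulse F f r * ∫ v, F v)|
        ≤ 2 * P ^ 2 * (Λ * T) * φ r := fun r hr => by
    have hrT : r ∈ Icc 0 T := ⟨hr.1, hr.2.trans hs.2⟩
    have hyr : spatialRadius R F f r < |y| := (hf.spatialRadius_mono hs hr).trans_lt hy
    have hφr : 0 ≤ φ r := (abs_nonneg _).trans (hbound r hrT y hyr)
    have hf_sub (v : ℝ) : |f r y v - F (v + sgn y * farImpulse F f r)| ≤ Λ * (φ r * r) :=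
      hf.abs_sub_translate_le hR hfar hΛ hrT (fun q hq z hz =>
        (hbound q ⟨hq.1, hq.2.trans hrT.2⟩ z hz).trans (hmono hq.2)) hyr v
    calc _ ≤ 2 * P ^ 2 * (Λ * (φ r * r)) := hf.abs_momentum_sub_far_le hfar hrT hf_sub
      _ ≤ 2 * P ^ 2 * (Λ * (φ r * T)) := by gcongr; exact hrT.2
      _ = 2 * P ^ 2 * (Λ * T) * φ r := by ring
  rw [hf.electricField_sub_far hfar hs (hf.lt_abs_of_spatialRadius_lt hs hy),
    ← intervalIntegral.integral_const_mul, ← Real.norm_eq_abs]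
  exact intervalIntegral.norm_integral_le_of_norm_le hs.1
    (Eventually.of_forall fun r hr => hstep r (Ioc_subset_Icc_self hr))
    ((hφ.const_mul _).intervalIntegrable _ _)

lemma eq_translate_exterior (hf : IsBoundedSolution T B P F f₀ f) (hR : 0 ≤ R)
    (hfar : ∀ x v, R < |x| → f₀ x v = F v) (ht : t ∈ Icc 0 T)
    (hx : spatialRadius R F f t < |x|) (v : ℝ) :
    f t x v = F (v + sgn x * farImpulse F f t) := by
  obtain ⟨Λ, hΛ⟩ := ContDiff.lipschitzWith_of_hasCompactSupport
    hf.hasCompactSupport_background hf.background_contDiff one_ne_zero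
  have h := hf.abs_sub_translate_le hR hfar hΛ ht (δ := 0) (fun s hs y hy => by
    rw [hf.electricField_exterior hR hfar ⟨hs.1, hs.2.trans ht.2⟩ hy, sub_self, abs_zero]) hx v
  rw [zero_mul, mul_zero] at h
  exact sub_eq_zero.1 (abs_nonpos_iff.1 h)

end IsBoundedSolution

end VlasovPoisson

open VlasovPoisson in
theorem theorem2_general (T R : ℝ) (hT : 0 < T) (hR : 0 ≤ R) (F : ℝ → ℝ) (f₀ : ℝ → ℝ → ℝ)
    (hF₀ : ∀ v, 0 ≤ F v) (hsupp : ∃ P : ℝ, ∀ x v, P < |v| → f₀ x v = 0)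
    (hfar : ∀ x v, R < |x| → f₀ x v = F v) (f : ℝ → ℝ → ℝ → ℝ) (hf : IsC1Solution T F f₀ f)
    (hE : IntervalIntegrable (fieldSupNorm F f) volume 0 T) (t : ℝ) (ht : t ∈ Icc 0 T) (x : ℝ)
    (hx : spatialRadius R F f t < |x|) :
    electricField F f t x =
        initialFieldStrength R F f₀ * sgn x * Real.cos (frequency F * t) ∧
      ∀ v : ℝ, f t x v =
        F (v + initialFieldStrength R F f₀ * sgn x / frequency F *
          Real.sin (frequency F * t)) := by
  obtain ⟨B, P, hb⟩ := hf.exists_isBoundedSolution hT hfar hsupp hE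
  obtain ⟨hcos, hsin⟩ := hb.halfCharge_eq_cos_and_farImpulse_eq_sin hR hfar hF₀ ht
  refine ⟨?_, fun v => ?_⟩
  · rw [hb.electricField_exterior hR hfar ht hx, hcos]
    ring
  · rw [hb.eq_translate_exterior hR hfar ht hx]
    by_cases hω : frequency F = 0
    · simp [eq_zero_of_frequency_eq_zero hb.background_contDiff.continuous hF₀
        hb.hasCompactSupport_background hω]
    · congr 2
      field_simp
      linear_combination sgn x * hsin

theorem theorem2 (T R : ℝ) (hT : 0 < T) (F : ℝ → ℝ) (f₀ : ℝ → ℝ → ℝ)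
    (hdata : VlasovPoisson.IsAdmissibleData R F f₀)
    (f : ℝ → ℝ → ℝ → ℝ) (hf : VlasovPoisson.IsC1Solution T F f₀ f)
    (hE : VlasovPoisson.HasFieldBound T F f)
    (t : ℝ) (ht : t ∈ Set.Icc 0 T) (x : ℝ) (hx : VlasovPoisson.spatialRadius R F f t < |x|) :
    VlasovPoisson.electricField F f t x =
        VlasovPoisson.initialFieldStrength R F f₀ * VlasovPoisson.sgn x *
          Real.cos (VlasovPoisson.frequency F * t) ∧
      ∀ v : ℝ, f t x v =
        F (v + VlasovPoisson.initialFieldStrength R F f₀ * VlasovPoisson.sgn x /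
          VlasovPoisson.frequency F * Real.sin (VlasovPoisson.frequency F * t)) :=
  theorem2_general T R hT hdata.radius_pos.le F f₀ hdata.background_nonneg
    hdata.initial_velocity_support hdata.initial_eq_background f hf hE.1 t ht x hx
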